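/- Let $\mathcal P=[X:\mathcal R]$ be a presentation of an inverse monoid $M$, where $\mathcal R\subseteq A^*\times A^*$ is a set of pairs of words over $A=X\sqcup X^{-1}$. Let $\rho:A^*\to \mathrm{FIM}(X)$ be the natural map onto the free inverse monoid and $\theta:\mathrm{FIM}(X)\to M$ the presentation map, so that $\theta$ is onto and its kernel is the congruence generated by the pairs $(l\rho,r\rho)$, $(l,r)\in\mathcal R$. Maps are written on the right. Let $\mathcal T=\mathrm{FIM}(X)/\theta_{\min}$, where $a\,\theta_{\min}\,b$ if and only if $ae=be$ for some idempotent $e$ with $(a^{-1}a)\theta=e\theta=(b^{-1}b)\theta$, and let $\tau:\mathrm{FIM}(X)\to\mathcal T$ and $\psi:\mathcal T\to M$ be the canonical maps, so $\theta=\tau\psi$. Let $E$ be the set of idempotents of $\mathcal T$; $\mathcal T$ is regarded as a groupoid with object set $E$, in which $t$ is an arrow from $tt^{-1}$ to $t^{-1}t$ and composition is the product of $\mathcal T$. A crossed module over a groupoid $G$ with object set $V$ consists of groups $C_e$ $(e\in V)$, homomorphisms $\partial:C_e\to G(e)$ into the vertex groups of $G$, and an action of $G$ by group homomorphisms $C_e\to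 C_f$, $c\mapsto c^g$ (for $g$ an arrow from $e$ to $f$), such that $(c^g)\partial=g^{-1}(c\partial)g$ and $c^{a\partial}=a^{-1}ca$ for $a,c\in C_e$. Morphisms are families of group homomorphisms commuting with $\partial$ and with the action. Given a set $R$ and a map $\omega$ from $R$ to the loops of $G$, a crossed $G$-module $(C,\partial)$ with a map $\nu:R\to C$ such that $\nu\partial=\omega$ is free on $\omega$ if for each crossed $G$-module $(C',\partial')$ and each $\sigma:R\to C'$ with $\sigma\partial'=\omega$ there is a unique morphism $\phi:C\to C'$ with $\nu\phi=\sigma$. The Squier complex $\mathrm{Sq}(\mathcal P)$ is the $2$-complex with vertex set $\mathcal T$, with an edge $(p,l,r,q)$ from $p(l\rho\tau)q$ to $p(r\rho\tau)q$ for all $p,q\in\mathcal T$, $(l,r)\in\mathcal R$, and with a $2$-cell making the edge paths $(p,l,r,qp'(l'\rho\tau)q')\circ(p(r\rho\tau)qp',l',r',q')$ and $(p(l\rho\tau)qp',l',r',q')\circ(p,l,r,qp'(r'\rho\tau)q')$ homotopic, for all $p,q,p',q'\in\mathcal T$ and $(l,r),(l',r')\in\mathcal R$. Let $\pi$ be its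 fundamental groupoid on the vertex set $\mathcal T$; write $\alpha\mathbf d$ and $\alpha\mathbf r$ for the initial and terminal vertex of $\alpha\in\pi$. The monoid $\mathcal T$ acts on $\pi$ on both sides through $t\rhd(p,l,r,q)=(tp,l,r,q)$ and $(p,l,r,q)\lhd t=(p,l,r,qt)$, and $\alpha\ast\beta=(\alpha\lhd\beta\mathbf d)\circ(\alpha\mathbf r\rhd\beta)$. For $e\in E$ the set $\mathrm{star}_e^{\bowtie}=\{e\rhd\alpha\lhd e:\alpha\in\pi,\ \alpha\mathbf d=e\}$ is a group under $\ast$, and $S^{\bowtie}=\bigsqcup_{e\in E}\mathrm{star}_e^{\bowtie}$, with boundary map $\mathbf r$ and action $\alpha^w=w^{-1}\rhd\alpha\lhd w$, is a crossed $\mathcal T$-module. Let $R$ be the set of triples $(l,r,x)$ with $(l,r)\in\mathcal R$, $x\in E$ and $(l^{-1}r)\rho\tau\psi\geqslant x\psi$ in the natural partial order of $M$, and let $\omega$ send $(l,r,x)$ to the loop $x\,((l^{-1}r)\rho\tau)\,x$ of $\mathcal T$ at $x$. Let $C\xrightarrow{\partial}\mathcal T\rightrightarrows E$ be constructed as follows: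 $F_e$ is the free group on the pairs $((l,r,x),g)$ with $(l,r,x)\in R$ and $g$ an arrow of $\mathcal T$ from $x$ to $e$; $\mathcal T$ acts by $(s,g)^h=(s,gh)$; $\delta:(s,g)\mapsto g^{-1}(s\omega)g$; and $C_e$ is the quotient of $F_e$ by the subgroup generated by all $u^{-1}v^{-1}u\,v^{u\delta}$ $(u,v\in F_e)$, which is normal, with the induced boundary map $\partial$ and action. Then $C$, with the map $(l,r,x)\mapsto((l,r,x),x)$, is the free crossed $\mathcal T$-module on $\omega$, and there is an isomorphism of crossed $\mathcal T$-modules from $C\xrightarrow{\partial}\mathcal T\rightrightarrows E$ to $S^{\bowtie}\xrightarrow{\mathbf r}\mathcal T\rightrightarrows E$ that sends the basis element given by $(l,r,x)$ to the homotopy class of the edge $(xh^{-1},l,r,x)$, where $h=l\rho\tau$. -/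

import Mathlib

open CategoryTheory

universe u v w

/-! ### Inverse monoids -/

/-- An inverse monoid: every `a` has a unique `b` with `a b a = a` and `b a b = b`, written `a⁻¹`. -/
class InverseMonoid (S : Type u) extends Monoid S, Inv S where
  mul_inv_mul : ∀ a : S, a * a⁻¹ * a = a
  inv_mul_inv : ∀ a : S, a⁻¹ * a * a⁻¹ = a⁻¹
  inv_unique : ∀ a b : S, a * b * a = a → b * a * b = b → b = a⁻¹

namespace InverseMonoid

/-- The equational form of the axioms. -/
@[reducible] def ofEquations {S : Type u} [Monoid S] (i : S → S) (i_i : ∀ a, i (i a) = a)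
    (i_mul : ∀ a b, i (a * b) = i b * i a) (reg : ∀ a, a * i a * a = a)
    (comm : ∀ a b, (a * i a) * (b * i b) = (b * i b) * (a * i a)) : InverseMonoid S where
  inv := i
  mul_inv_mul := reg
  inv_mul_inv a := by
    have h := reg (i a)
    rwa [i_i] at h
  inv_unique a b h₁ h₂ := by
    have reg' : ∀ a, i a * a * i a = i a := fun a => by
      have h := reg (i a)
      rwa [i_i] at h
    have self : ∀ e : S, e * e = e → i e = e := fun e he => by
      have c := comm (i e) e
      rw [i_i] at c
      have hie : i e * i e = i e := by rw [← i_mul, he]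
      calc i e = i e * (e * e) * i e := by rw [he, reg']
        _ = (i e * e) * (e * i e) := by simp only [mul_assoc]
        _ = (e * i e) * (i e * e) := c
        _ = e * (i e * i e) * e := by simp only [mul_assoc]
        _ = e := by rw [hie, reg]
    have idc : ∀ e f : S, e * e = e → f * f = f → e * f = f * e := fun e f he hf => by
      have h := comm e f
      rwa [self e he, self f hf, he, hf] at h
    have k₁ : (a * b) * (a * i a) = (a * i a) * (a * b) :=
      idc _ _ (by rw [← mul_assoc, h₁]) (by rw [← mul_assoc, reg])
    have k₂ : (b * a) * (i a * a) = (i a * a) * (b * a) :=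
      idc _ _ (by rw [← mul_assoc, h₂]) (by rw [← mul_assoc, reg'])
    have e₁ : b = i a * a * b := by
      calc b = b * a * b := h₂.symm
        _ = b * (a * i a * a) * b := by rw [reg]
        _ = (b * a) * (i a * a) * b := by simp only [mul_assoc]
        _ = i a * a * (b * a * b) := by rw [k₂]; simp only [mul_assoc]
        _ = i a * a * b := by rw [h₂]
    have e₂ : i a = i a * a * b := by
      calc i a = i a * a * i a := (reg' a).symm
        _ = i a * (a * b * a) * i a := by rw [h₁]
        _ = i a * ((a * b) * (a * i a)) := by simp only [mul_assoc]
        _ = (i a * a * i a) * a * b := by rw [k₁]; simp only [mul_assoc]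
        _ = i a * a * b := by rw [reg']
    exact e₁.trans e₂.symm

variable {S : Type u} [InverseMonoid S]

theorem inv_inv' (a : S) : a⁻¹⁻¹ = a :=
  (inv_unique a⁻¹ a (inv_mul_inv a) (mul_inv_mul a)).symm

theorem idem_inv {e : S} (he : e * e = e) : e⁻¹ = e :=
  (inv_unique e e (by rw [he, he]) (by rw [he, he])).symm

theorem idem_mul_inv (a : S) : (a * a⁻¹) * (a * a⁻¹) = a * a⁻¹ := by
  rw [← mul_assoc, mul_inv_mul]

theorem idem_inv_mul (a : S) : (a⁻¹ * a) * (a⁻¹ * a) = a⁻¹ * a := by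
  rw [← mul_assoc, inv_mul_inv]

theorem idem_mul {e f : S} (he : e * e = e) (hf : f * f = f) : (e * f) * (e * f) = e * f := by
  have hx : e * f = (f * (e * f)⁻¹ * e)⁻¹ := by
    apply inv_unique
    · calc f * (e * f)⁻¹ * e * (e * f) * (f * (e * f)⁻¹ * e)
          = f * (e * f)⁻¹ * (e * e) * (f * f) * (e * f)⁻¹ * e := by simp only [mul_assoc]
        _ = f * ((e * f)⁻¹ * (e * f) * (e * f)⁻¹) * e := by rw [he, hf]; simp only [mul_assoc]
        _ = _ := by rw [inv_mul_inv]
    · calc e * f * (f * (e * f)⁻¹ * e) * (e * f)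
          = e * (f * f) * (e * f)⁻¹ * (e * e) * f := by simp only [mul_assoc]
        _ = (e * f) * (e * f)⁻¹ * (e * f) := by rw [he, hf]; simp only [mul_assoc]
        _ = _ := mul_inv_mul _
  have hi : (f * (e * f)⁻¹ * e) * (f * (e * f)⁻¹ * e) = f * (e * f)⁻¹ * e := by
    calc (f * (e * f)⁻¹ * e) * (f * (e * f)⁻¹ * e)
          = f * ((e * f)⁻¹ * (e * f) * (e * f)⁻¹) * e := by simp only [mul_assoc]
      _ = _ := by rw [inv_mul_inv]
  rw [idem_inv hi] at hx
  rw [hx, hi]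

theorem idem_comm {e f : S} (he : e * e = e) (hf : f * f = f) : e * f = f * e := by
  have h₁ := idem_mul he hf
  have h₂ := idem_mul hf he
  have : f * e = (e * f)⁻¹ := by
    apply inv_unique
    · calc e * f * (f * e) * (e * f) = e * (f * f) * (e * e) * f := by simp only [mul_assoc]
        _ = (e * f) * (e * f) := by rw [he, hf]; simp only [mul_assoc]
        _ = _ := h₁
    · calc f * e * (e * f) * (f * e) = f * (e * e) * (f * f) * e := by simp only [mul_assoc]
        _ = (f * e) * (f * e) := by rw [he, hf]; simp only [mul_assoc]
        _ = _ := h₂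
  rw [this, idem_inv h₁]

theorem mul_inv' (a b : S) : (a * b)⁻¹ = b⁻¹ * a⁻¹ := by
  symm
  have c := idem_comm (idem_mul_inv b) (idem_inv_mul a)
  apply inv_unique
  · calc a * b * (b⁻¹ * a⁻¹) * (a * b) = a * ((b * b⁻¹) * (a⁻¹ * a)) * b := by
          simp only [mul_assoc]
      _ = (a * a⁻¹ * a) * (b * b⁻¹ * b) := by rw [c]; simp only [mul_assoc]
      _ = _ := by rw [mul_inv_mul, mul_inv_mul]
  · calc b⁻¹ * a⁻¹ * (a * b) * (b⁻¹ * a⁻¹) = b⁻¹ * ((a⁻¹ * a) * (b * b⁻¹)) * a⁻¹ := by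
          simp only [mul_assoc]
      _ = (b⁻¹ * b * b⁻¹) * (a⁻¹ * a * a⁻¹) := by rw [← c]; simp only [mul_assoc]
      _ = _ := by rw [inv_mul_inv, inv_mul_inv]

theorem map_inv' {N : Type v} [InverseMonoid N] (φ : S →* N) (a : S) : φ a⁻¹ = (φ a)⁻¹ :=
  inv_unique _ _ (by rw [← map_mul, ← map_mul, mul_inv_mul])
    (by rw [← map_mul, ← map_mul, inv_mul_inv])

theorem idem_conj (a : S) {e : S} (he : e * e = e) :
    (a⁻¹ * e * a) * (a⁻¹ * e * a) = a⁻¹ * e * a := by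
  calc (a⁻¹ * e * a) * (a⁻¹ * e * a) = a⁻¹ * (e * (a * a⁻¹)) * e * a := by simp only [mul_assoc]
    _ = (a⁻¹ * a * a⁻¹) * (e * e) * a := by
        rw [idem_comm he (idem_mul_inv a)]; simp only [mul_assoc]
    _ = _ := by rw [inv_mul_inv, he]

theorem con_inv (c : Con S) {a b : S} (h : c a b) : c a⁻¹ b⁻¹ := by
  rw [← c.eq] at h ⊢
  have x₁ : (↑a⁻¹ : c.Quotient) * ↑a * ↑a⁻¹ = ↑a⁻¹ := by
    rw [← c.coe_mul, ← c.coe_mul, inv_mul_inv]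
  have x₂ : (↑a : c.Quotient) * ↑a⁻¹ * ↑a = ↑a := by
    rw [← c.coe_mul, ← c.coe_mul, mul_inv_mul]
  have y₁ : (↑b⁻¹ : c.Quotient) * ↑a * ↑b⁻¹ = ↑b⁻¹ := by
    rw [h, ← c.coe_mul, ← c.coe_mul, inv_mul_inv]
  have y₂ : (↑a : c.Quotient) * ↑b⁻¹ * ↑a = ↑a := by
    rw [h, ← c.coe_mul, ← c.coe_mul, mul_inv_mul]
  have c₁ : ((↑a⁻¹ : c.Quotient) * ↑a) * (↑b⁻¹ * ↑a) = (↑b⁻¹ * ↑a) * (↑a⁻¹ * ↑a) := by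
    have := congrArg (fun s : S => (s : c.Quotient)) (idem_comm (idem_inv_mul a) (idem_inv_mul b))
    simp only [c.coe_mul] at this
    rwa [← h] at this
  have c₂ : ((↑a : c.Quotient) * ↑a⁻¹) * (↑a * ↑b⁻¹) = (↑a * ↑b⁻¹) * (↑a * ↑a⁻¹) := by
    have := congrArg (fun s : S => (s : c.Quotient)) (idem_comm (idem_mul_inv a) (idem_mul_inv b))
    simp only [c.coe_mul] at this
    rwa [← h] at this
  generalize (↑a⁻¹ : c.Quotient) = x at *
  generalize (↑b⁻¹ : c.Quotient) = y at *
  generalize (↑a : c.Quotient) = z at *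
  calc x = x * (z * y * z) * x := by rw [y₂, x₁]
    _ = (x * z) * (y * z) * x := by simp only [mul_assoc]
    _ = y * z * (x * z * x) := by rw [c₁]; simp only [mul_assoc]
    _ = y * (z * y * z) * x := by rw [x₁, y₂]
    _ = y * ((z * y) * (z * x)) := by simp only [mul_assoc]
    _ = y * (z * x * z) * y := by rw [← c₂]; simp only [mul_assoc]
    _ = y := by rw [x₂, y₁]

/-- A quotient of an inverse monoid by a monoid congruence is an inverse monoid. -/
instance conQuotient (c : Con S) : InverseMonoid c.Quotient :=
  ofEquations (Quotient.map' (fun a : S => a⁻¹) fun _ _ h => con_inv c h)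
    (by rintro ⟨a⟩; exact congrArg (fun s : S => (s : c.Quotient)) (inv_inv' a))
    (by rintro ⟨a⟩ ⟨b⟩; exact congrArg (fun s : S => (s : c.Quotient)) (mul_inv' a b))
    (by rintro ⟨a⟩; exact congrArg (fun s : S => (s : c.Quotient)) (mul_inv_mul a))
    (by
      rintro ⟨a⟩ ⟨b⟩
      exact congrArg (fun s : S => (s : c.Quotient))
        (idem_comm (idem_mul_inv a) (idem_mul_inv b)))

/-- The natural partial order: `NatLE a b` means `a ≤ b`. -/
def NatLE (a b : S) : Prop := ∃ e : S, e * e = e ∧ a = b * e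

/-- For a homomorphism `θ` with kernel congruence `κ`, the smallest congruence with the same
trace as `κ`: `a ∼ b` iff there is an idempotent `e` with `a e = b e` and
`a⁻¹ a κ e κ b⁻¹ b`. -/
def minCon {N : Type v} [InverseMonoid N] (θ : S →* N) : Con S where
  r a b := ∃ e : S, e * e = e ∧ a * e = b * e ∧ θ (a⁻¹ * a) = θ e ∧ θ e = θ (b⁻¹ * b)
  iseqv :=
    { refl := fun a => ⟨a⁻¹ * a, idem_inv_mul a, rfl, rfl, rfl⟩
      symm := fun ⟨e, he, h, h₁, h₂⟩ => ⟨e, he, h.symm, h₂.symm, h₁.symm⟩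
      trans := by
        rintro a b c ⟨e, he, h, h₁, h₂⟩ ⟨f, hf, k, k₁, k₂⟩
        have hef : θ e = θ f := h₂.trans k₁
        have hθ : θ (e * f) = θ e := by rw [map_mul, ← hef, ← map_mul, he]
        refine ⟨e * f, idem_mul he hf, ?_, h₁.trans hθ.symm, hθ.trans (hef.trans k₂)⟩
        rw [← mul_assoc, h, mul_assoc, idem_comm he hf, ← mul_assoc, k, mul_assoc] }
  mul' := by
    rintro a b c d ⟨e, he, h, h₁, h₂⟩ ⟨f, hf, k, k₁, k₂⟩
    have hfi := idem_inv hf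
    have hei := idem_inv he
    have key : ∀ x y : S, x * y * ((y * f)⁻¹ * e * (y * f)) = x * e * (y * f) := by
      intro x y
      have hy : y * (y * f)⁻¹ = (y * f) * (y * f)⁻¹ := by
        rw [mul_inv', hfi, ← mul_assoc, ← mul_assoc, mul_assoc y f f, hf]
      calc x * y * ((y * f)⁻¹ * e * (y * f)) = x * (y * (y * f)⁻¹) * e * (y * f) := by
            simp only [mul_assoc]
        _ = x * ((y * f * (y * f)⁻¹) * e) * (y * f) := by rw [hy]; simp only [mul_assoc]
        _ = x * e * (y * f * (y * f)⁻¹ * (y * f)) := by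
            rw [idem_comm (idem_mul_inv _) he]; simp only [mul_assoc]
        _ = _ := by rw [mul_inv_mul]
    have hc : ∀ y : S, θ f = θ (y⁻¹ * y) → θ (y * f) = θ y := fun y hy => by
      rw [map_mul, hy, ← map_mul, ← mul_assoc, mul_inv_mul]
    have hθ : ∀ x y : S, θ e = θ (x⁻¹ * x) → θ f = θ (y⁻¹ * y) →
        θ ((y * f)⁻¹ * e * (y * f)) = θ ((x * y)⁻¹ * (x * y)) := fun x y hx hy => by
      rw [map_mul, map_mul, map_inv', hc y hy, hx, mul_inv', ← map_inv', ← map_mul, ← map_mul]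
      simp only [mul_assoc]
    refine ⟨(c * f)⁻¹ * e * (c * f), idem_conj _ he, ?_, (hθ a c h₁.symm k₁.symm).symm, ?_⟩
    · rw [key, k, key, h]
    · rw [k]; exact hθ b d h₂ k₂

/-- An idempotent of an inverse monoid. -/
@[ext] structure Idem (S : Type u) [InverseMonoid S] : Type u where
  val : S
  idem : val * val = val

/-- An element `t` with `t t⁻¹ = e` and `t⁻¹ t = f`. -/
@[ext] structure Arrow {S : Type u} [InverseMonoid S] (e f : Idem S) : Type u where
  val : S
  dom : val * val⁻¹ = e.val
  cod : val⁻¹ * val = f.val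

theorem Arrow.dom_mul {e f : Idem S} (s : Arrow e f) : e.val * s.val = s.val := by
  rw [← s.dom, mul_inv_mul]

theorem Arrow.mul_cod {e f : Idem S} (s : Arrow e f) : s.val * f.val = s.val := by
  rw [← s.cod, ← mul_assoc, mul_inv_mul]

/-- An inverse monoid as a groupoid under the restricted product: objects are the idempotents, an
element `t` is an arrow from `t t⁻¹` to `t⁻¹ t`, and composition is multiplication. -/
instance traceGroupoid (S : Type u) [InverseMonoid S] : Groupoid (Idem S) where
  Hom e f := Arrow e f
  id e := ⟨e.val, by rw [idem_inv e.idem, e.idem], by rw [idem_inv e.idem, e.idem]⟩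
  comp s t := ⟨s.val * t.val, by
      rw [mul_inv', mul_assoc, ← mul_assoc t.val, t.dom, ← mul_assoc, s.mul_cod, s.dom], by
      rw [mul_inv', mul_assoc, ← mul_assoc _ s.val, s.cod, t.dom_mul, t.cod]⟩
  id_comp s := Arrow.ext s.dom_mul
  comp_id s := Arrow.ext s.mul_cod
  assoc s t r := Arrow.ext (mul_assoc s.val t.val r.val)
  inv s := ⟨s.val⁻¹, by rw [inv_inv', s.cod], by rw [inv_inv', s.dom]⟩
  inv_comp s := Arrow.ext s.cod
  comp_inv s := Arrow.ext s.dom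

end InverseMonoid

/-! ### Crossed modules of groupoids -/

/-- A crossed module over a groupoid with object set `V`. Composition in the groupoid and the
product of the vertex groups `e ⟶ e` are written in the same order: `g h` is `g ≫ h`. -/
structure CrossedModule (V : Type u) [Groupoid.{v} V] where
  C : V → Type w
  [group : ∀ e, Group (C e)]
  bd : ∀ e, C e →* (e ⟶ e)
  act : ∀ {e f : V}, (e ⟶ f) → (C e →* C f)
  act_id : ∀ (e : V) (c : C e), act (𝟙 e) c = c
  act_comp : ∀ {e f k : V} (g : e ⟶ f) (h : f ⟶ k) (c : C e), act (g ≫ h) c = act h (act g c)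
  bd_act : ∀ {e f : V} (g : e ⟶ f) (c : C e), bd f (act g c) = Groupoid.inv g ≫ bd e c ≫ g
  act_bd : ∀ {e : V} (a c : C e), act (bd e a) c = a⁻¹ * c * a

namespace CrossedModule

attribute [instance] CrossedModule.group

universe w₁ w₂

variable {V : Type u} [Groupoid.{v} V]

/-- A morphism of crossed modules over a fixed groupoid. -/
@[ext] structure Hom (A : CrossedModule.{u, v, w₁} V) (B : CrossedModule.{u, v, w₂} V) where
  map : ∀ e, A.C e →* B.C e
  bd_map : ∀ (e : V) (c : A.C e), B.bd e (map e c) = A.bd e c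
  act_map : ∀ {e f : V} (g : e ⟶ f) (c : A.C e), map f (A.act g c) = B.act g (map e c)

/-- An isomorphism of crossed modules over a fixed groupoid. -/
structure Iso (A : CrossedModule.{u, v, w₁} V) (B : CrossedModule.{u, v, w₂} V) where
  map : ∀ e, A.C e ≃* B.C e
  bd_map : ∀ (e : V) (c : A.C e), B.bd e (map e c) = A.bd e c
  act_map : ∀ {e f : V} (g : e ⟶ f) (c : A.C e), map f (A.act g c) = B.act g (map e c)

/-- `A`, together with `ν`, is the free crossed module on `ω`, where `ω` assigns to each `r : R` a
loop of the groupoid at the object `b r`. -/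
def IsFreeOn {R : Type w} (A : CrossedModule.{u, v, w₁} V) (b : R → V) (ω : ∀ r, b r ⟶ b r)
    (ν : ∀ r, A.C (b r)) : Prop :=
  (∀ r, A.bd (b r) (ν r) = ω r) ∧
  ∀ (B : CrossedModule.{u, v, w₂} V) (σ : ∀ r, B.C (b r)), (∀ r, B.bd (b r) (σ r) = ω r) →
    ∃! φ : Hom A B, ∀ r, φ.map (b r) (ν r) = σ r

section Free

variable {R : Type w} (b : R → V) (ω : ∀ r, b r ⟶ b r)

/-- The generators at `e`: pairs `(r, g)` with `g` an arrow from the base point of `r` to `e`. -/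
structure FreeGen (e : V) : Type (max v w) where
  fst : R
  snd : b fst ⟶ e

/-- The boundary of the free pre-crossed module, `(r, g) ↦ g⁻¹ (ω r) g`. -/
def freeBd (e : V) : FreeGroup (FreeGen b e) →* (e ⟶ e) :=
  FreeGroup.lift fun s => Groupoid.inv s.snd ≫ ω s.fst ≫ s.snd

/-- The action on the free pre-crossed module, `(r, g)^h = (r, g h)`. -/
def freeAct {e f : V} (h : e ⟶ f) : FreeGroup (FreeGen b e) →* FreeGroup (FreeGen b f) :=
  FreeGroup.map fun s => ⟨s.fst, s.snd ≫ h⟩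

/-- The Peiffer subgroup at `e`, generated by the elements `u⁻¹ v⁻¹ u v^{δ u}`. -/
def peiffer (e : V) : Subgroup (FreeGroup (FreeGen b e)) :=
  Subgroup.closure {x | ∃ u v, x = u⁻¹ * v⁻¹ * u * freeAct b (freeBd b ω e u) v}

theorem freeAct_of {e f : V} (h : e ⟶ f) (s : FreeGen b e) :
    freeAct b h (FreeGroup.of s) = FreeGroup.of ⟨s.fst, s.snd ≫ h⟩ := FreeGroup.map.of

theorem freeBd_of (e : V) (s : FreeGen b e) :
    freeBd b ω e (FreeGroup.of s) = Groupoid.inv s.snd ≫ ω s.fst ≫ s.snd := FreeGroup.lift_apply_of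

theorem freeAct_id (e : V) (x : FreeGroup (FreeGen b e)) : freeAct b (𝟙 e) x = x := by
  have : freeAct b (𝟙 e) = MonoidHom.id _ := by
    apply FreeGroup.ext_hom
    intro s
    rw [freeAct_of, Category.comp_id]
    rfl
  rw [this]
  rfl

theorem freeAct_comp {e f k : V} (g : e ⟶ f) (h : f ⟶ k) (x : FreeGroup (FreeGen b e)) :
    freeAct b (g ≫ h) x = freeAct b h (freeAct b g x) := by
  have : freeAct b (g ≫ h) = (freeAct b h).comp (freeAct b g) := by
    apply FreeGroup.ext_hom
    intro s
    rw [MonoidHom.comp_apply, freeAct_of, freeAct_of, freeAct_of, Category.assoc]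
  rw [this]
  rfl

theorem freeBd_act {e f : V} (g : e ⟶ f) (x : FreeGroup (FreeGen b e)) :
    freeBd b ω f (freeAct b g x) = Groupoid.inv g ≫ freeBd b ω e x ≫ g := by
  have : (freeBd b ω f).comp (freeAct b g) =
      (Groupoid.vertexGroupIsomOfMap g).toMonoidHom.comp (freeBd b ω e) := by
    apply FreeGroup.ext_hom
    intro s
    rw [MonoidHom.comp_apply, freeAct_of, freeBd_of, MonoidHom.comp_apply, freeBd_of]
    simp [Groupoid.inv_eq_inv]
  exact DFunLike.congr_fun this x

theorem freeAct_peiffer {e f : V} (g : e ⟶ f) (u v : FreeGroup (FreeGen b e)) :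
    freeAct b g (freeAct b (freeBd b ω e u) v) =
      freeAct b (freeBd b ω f (freeAct b g u)) (freeAct b g v) := by
  rw [freeBd_act, ← freeAct_comp, ← freeAct_comp]
  simp [Groupoid.inv_eq_inv]

instance peiffer_normal (e : V) : (peiffer b ω e).Normal := by
  refine ⟨fun n hn g => ?_⟩
  have key : peiffer b ω e ≤ (peiffer b ω e).comap (MulAut.conj g).toMonoidHom := by
    refine (Subgroup.closure_le _).2 ?_
    rintro _ ⟨u, v, rfl⟩
    have h₁ : (u * g⁻¹)⁻¹ * v⁻¹ * (u * g⁻¹) * freeAct b (freeBd b ω e (u * g⁻¹)) v ∈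
        peiffer b ω e := Subgroup.subset_closure ⟨_, _, rfl⟩
    have h₂ : (g⁻¹)⁻¹ * (freeAct b (freeBd b ω e u) v)⁻¹ * g⁻¹ *
        freeAct b (freeBd b ω e g⁻¹) (freeAct b (freeBd b ω e u) v) ∈
        peiffer b ω e := Subgroup.subset_closure ⟨_, _, rfl⟩
    have h₃ := mul_mem h₁ (inv_mem h₂)
    rw [map_mul (freeBd b ω e) u, Groupoid.vertexGroup_mul, freeAct_comp] at h₃
    change g * _ * g⁻¹ ∈ peiffer b ω e
    convert h₃ using 1
    group
  exact key hn

/-- The free crossed module on `ω`: the quotient of the free pre-crossed module by the Peiffer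
subgroups. -/
def free : CrossedModule.{u, v, max v w} V where
  C e := FreeGroup (FreeGen b e) ⧸ peiffer b ω e
  bd e := QuotientGroup.lift (peiffer b ω e) (freeBd b ω e) (by
    refine (Subgroup.closure_le (MonoidHom.ker (freeBd b ω e))).2 ?_
    rintro _ ⟨u, v, rfl⟩
    simp only [SetLike.mem_coe, MonoidHom.mem_ker, map_mul, map_inv, freeBd_act]
    rw [← Groupoid.vertexGroup_inv, ← Groupoid.vertexGroup_mul, ← Groupoid.vertexGroup_mul]
    group)
  act {e f} g := QuotientGroup.map _ _ (freeAct b g) (by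
    refine (Subgroup.closure_le _).2 ?_
    rintro _ ⟨u, v, rfl⟩
    refine Subgroup.subset_closure ⟨freeAct b g u, freeAct b g v, ?_⟩
    rw [map_mul, map_mul, map_mul, map_inv, map_inv, freeAct_peiffer])
  act_id e := by
    rintro ⟨c⟩
    exact congrArg _ (freeAct_id b e c)
  act_comp g h := by
    rintro ⟨c⟩
    exact congrArg _ (freeAct_comp b g h c)
  bd_act g := by
    rintro ⟨c⟩
    exact freeBd_act b ω g c
  act_bd {e} := by
    rintro ⟨a⟩ ⟨c⟩
    refine (QuotientGroup.eq.2 ?_ : ((a⁻¹ * c * a : FreeGroup (FreeGen b e)) :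
      FreeGroup (FreeGen b e) ⧸ peiffer b ω e) = (freeAct b (freeBd b ω e a) c :)).symm
    refine Subgroup.subset_closure ⟨a, c, ?_⟩
    group

/-- The basis of the free crossed module: `r ↦ (r, 1)`. -/
def freeBasis (r : R) : (free b ω).C (b r) :=
  QuotientGroup.mk' (peiffer b ω (b r)) (FreeGroup.of ⟨r, 𝟙 (b r)⟩)

end Free

end CrossedModule

/-! ### Inverse monoid presentations -/

section Presentation

open InverseMonoid

/-- Words in the alphabet `X ⊔ X⁻¹`; `(x, true)` stands for `x` and `(x, false)` for `x⁻¹`. -/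
abbrev Words (X : Type u) : Type u := FreeMonoid (X × Bool)

/-- The formal inverse of a word. -/
def wordInv {X : Type u} (p : Words X) : Words X :=
  FreeMonoid.ofList (FreeGroup.invRev p.toList)

theorem wordInv_wordInv {X : Type u} (p : Words X) : wordInv (wordInv p) = p :=
  FreeGroup.invRev_invRev

theorem wordInv_mul {X : Type u} (p q : Words X) : wordInv (p * q) = wordInv q * wordInv p := by
  change FreeGroup.invRev (p.toList ++ q.toList) = _
  simp [FreeGroup.invRev, wordInv]
  rfl

/-- Generators of the Wagner congruence. -/
inductive WagnerRel (X : Type u) : Words X → Words X → Prop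
  | regular (p : Words X) : WagnerRel X (p * wordInv p * p) p
  | comm (p q : Words X) :
      WagnerRel X ((p * wordInv p) * (q * wordInv q)) ((q * wordInv q) * (p * wordInv p))

/-- The Wagner congruence. -/
def wagner (X : Type u) : Con (Words X) := conGen (WagnerRel X)

/-- The free inverse monoid on `X`. -/
def FIM (X : Type u) : Type u := (wagner X).Quotient

theorem wagner_inv {X : Type u} {p q : Words X} (h : wagner X p q) :
    wagner X (wordInv p) (wordInv q) := by
  induction h with
  | of x y h =>
    cases h with
    | regular =>
      rw [wordInv_mul, wordInv_mul, wordInv_wordInv, ← mul_assoc]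
      have := WagnerRel.regular (wordInv y)
      rw [wordInv_wordInv] at this
      exact ConGen.Rel.of _ _ this
    | comm p q =>
      simp only [wordInv_mul, wordInv_wordInv]
      exact ConGen.Rel.of _ _ (WagnerRel.comm q p)
  | refl x => exact (wagner X).refl _
  | symm _ ih => exact (wagner X).symm ih
  | trans _ _ ih₁ ih₂ => exact (wagner X).trans ih₁ ih₂
  | mul _ _ ih₁ ih₂ =>
    rw [wordInv_mul, wordInv_mul]
    exact (wagner X).mul ih₂ ih₁

instance (X : Type u) : InverseMonoid (FIM X) :=
  letI : Monoid (FIM X) := inferInstanceAs (Monoid (wagner X).Quotient)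
  InverseMonoid.ofEquations (S := FIM X)
    (Quotient.map' (s₁ := (wagner X).toSetoid) (s₂ := (wagner X).toSetoid) wordInv
      fun _ _ h => wagner_inv h)
    (by rintro ⟨a⟩; exact congrArg (fun s : Words X => (s : (wagner X).Quotient)) (wordInv_wordInv a))
    (by rintro ⟨a⟩ ⟨b⟩; exact congrArg (fun s : Words X => (s : (wagner X).Quotient)) (wordInv_mul a b))
    (by rintro ⟨a⟩; exact (wagner X).eq.2 (ConGen.Rel.of _ _ (WagnerRel.regular a)))
    (by rintro ⟨a⟩ ⟨b⟩; exact (wagner X).eq.2 (ConGen.Rel.of _ _ (WagnerRel.comm a b)))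

/-- The natural map `ρ` from words to the free inverse monoid. -/
def FIM.ρ (X : Type u) : Words X →* FIM X := (wagner X).mk'

/-- A presentation `[X : rels]` of the inverse monoid `M`, with presentation map `θ`: the map `θ`
is onto, and its kernel is the congruence on the free inverse monoid generated by the relations. -/
structure InvPresentation (X : Type u) (M : Type v) [InverseMonoid M] where
  rels : Set (Words X × Words X)
  θ : FIM X →* M
  surjective : Function.Surjective θ
  ker_eq : Con.ker θ = conGen fun a b => ∃ s ∈ rels, a = FIM.ρ X s.1 ∧ b = FIM.ρ X s.2

namespace InvPresentation

variable {X : Type u} {M : Type v} [InverseMonoid M] (P : InvPresentation X M)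

/-- The inverse monoid `𝒯 = FIM(X) / θ_min`. -/
abbrev T : Type u := (minCon P.θ).Quotient

/-- The canonical map `τ : FIM(X) → 𝒯`. -/
def τ : FIM X →* P.T := (minCon P.θ).mk'

/-- The canonical map `ψ : 𝒯 → M`. -/
def ψ : P.T →* M := (minCon P.θ).lift P.θ (by
  rintro a b ⟨e, -, h, h₁, h₂⟩
  change P.θ a = P.θ b
  calc P.θ a = P.θ a * P.θ (a⁻¹ * a) := by rw [← map_mul, ← mul_assoc, mul_inv_mul]
    _ = P.θ (b * e) := by rw [h₁, ← map_mul, h]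
    _ = P.θ b := by rw [map_mul, h₂, ← map_mul, ← mul_assoc, mul_inv_mul])

/-- The composite `ρ τ` from words to `𝒯`. -/
def ρτ : Words X →* P.T := P.τ.comp (FIM.ρ X)

theorem ψ_τ (a : FIM X) : P.ψ (P.τ a) = P.θ a := rfl

theorem ρτ_wordInv (p : Words X) : P.ρτ (wordInv p) = (P.ρτ p)⁻¹ := rfl

theorem ψ_idem {e f : P.T} (he : e * e = e) (hf : f * f = f) (h : P.ψ e = P.ψ f) : e = f := by
  have lift : ∀ g : P.T, g * g = g → ∃ a : FIM X, a * a = a ∧ P.τ a = g := by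
    intro g hg
    obtain ⟨a, rfl⟩ := Con.mk'_surjective g
    refine ⟨a * a⁻¹, idem_mul_inv a, ?_⟩
    change P.τ (a * a⁻¹) = P.τ a
    have hg' : P.τ a * P.τ a = P.τ a := hg
    rw [map_mul, map_inv', idem_inv hg', hg']
  obtain ⟨a, ha, rfl⟩ := lift e he
  obtain ⟨b, hb, rfl⟩ := lift f hf
  rw [ψ_τ, ψ_τ] at h
  refine (minCon P.θ).eq.2 ⟨a * b, idem_mul ha hb, ?_, ?_, ?_⟩
  · rw [← mul_assoc, ha, ← mul_assoc, idem_comm hb ha, mul_assoc, hb]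
  · rw [idem_inv ha, ha, map_mul, ← h, ← map_mul, ha]
  · rw [idem_inv hb, hb, map_mul, h, ← map_mul, hb]

theorem ψ_rel (s : P.rels) : P.ψ (P.ρτ s.1.1) = P.ψ (P.ρτ s.1.2) := by
  have h : Con.ker P.θ (FIM.ρ X s.1.1) (FIM.ρ X s.1.2) := by
    rw [P.ker_eq]
    exact ConGen.Rel.of _ _ ⟨s.1, s.2, rfl, rfl⟩
  exact h

/-- If `a ψ` is an idempotent `e ψ` then `a a⁻¹ = e = a⁻¹ a`. -/
theorem ψ_ker {a e : P.T} (he : e * e = e) (h : P.ψ a = P.ψ e) :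
    a * a⁻¹ = e ∧ a⁻¹ * a = e := by
  constructor
  · apply P.ψ_idem (idem_mul_inv a) he
    rw [map_mul, map_inv', h, ← map_inv', ← map_mul, idem_inv he, he]
  · apply P.ψ_idem (idem_inv_mul a) he
    rw [map_mul, map_inv', h, ← map_inv', ← map_mul, idem_inv he, he]

/-! #### The Squier complex and its fundamental groupoid -/

/-- An edge `(p, l, r, q)` of the Squier complex, where `rel = (l, r)`. -/
@[ext] structure Edge where
  p : P.T
  rel : P.rels
  q : P.T

/-- An edge with an orientation; `fwd = false` is the edge traversed backwards. -/
@[ext] structure SEdge where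
  edge : P.Edge
  fwd : Bool

variable {P}

/-- The initial vertex `p (l ρ τ) q`. -/
def Edge.dom (s : P.Edge) : P.T := s.p * P.ρτ s.rel.1.1 * s.q

/-- The terminal vertex `p (r ρ τ) q`. -/
def Edge.cod (s : P.Edge) : P.T := s.p * P.ρτ s.rel.1.2 * s.q

namespace SEdge

def dom (s : P.SEdge) : P.T := bif s.fwd then s.edge.dom else s.edge.cod

def cod (s : P.SEdge) : P.T := bif s.fwd then s.edge.cod else s.edge.dom

def inv (s : P.SEdge) : P.SEdge := ⟨s.edge, !s.fwd⟩

/-- `x ▷ (p, l, r, q) = (x p, l, r, q)`. -/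
def lw (x : P.T) (s : P.SEdge) : P.SEdge := ⟨⟨x * s.edge.p, s.edge.rel, s.edge.q⟩, s.fwd⟩

/-- `(p, l, r, q) ◁ x = (p, l, r, q x)`. -/
def rw (x : P.T) (s : P.SEdge) : P.SEdge := ⟨⟨s.edge.p, s.edge.rel, s.edge.q * x⟩, s.fwd⟩

theorem dom_inv (s : P.SEdge) : s.inv.dom = s.cod := by
  obtain ⟨s, _ | _⟩ := s <;> rfl

theorem cod_inv (s : P.SEdge) : s.inv.cod = s.dom := by
  obtain ⟨s, _ | _⟩ := s <;> rfl

theorem inv_inv (s : P.SEdge) : s.inv.inv = s := by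
  obtain ⟨s, _ | _⟩ := s <;> rfl

theorem dom_lw (x : P.T) (s : P.SEdge) : (s.lw x).dom = x * s.dom := by
  obtain ⟨s, _ | _⟩ := s <;> simp [dom, lw, Edge.dom, Edge.cod, mul_assoc]

theorem cod_lw (x : P.T) (s : P.SEdge) : (s.lw x).cod = x * s.cod := by
  obtain ⟨s, _ | _⟩ := s <;> simp [cod, lw, Edge.dom, Edge.cod, mul_assoc]

theorem dom_rw (x : P.T) (s : P.SEdge) : (s.rw x).dom = s.dom * x := by
  obtain ⟨s, _ | _⟩ := s <;> simp [dom, rw, Edge.dom, Edge.cod, mul_assoc]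

theorem cod_rw (x : P.T) (s : P.SEdge) : (s.rw x).cod = s.cod * x := by
  obtain ⟨s, _ | _⟩ := s <;> simp [cod, rw, Edge.dom, Edge.cod, mul_assoc]

theorem lw_lw (x y : P.T) (s : P.SEdge) : (s.lw y).lw x = s.lw (x * y) := by
  simp [lw, mul_assoc]

theorem rw_rw (x y : P.T) (s : P.SEdge) : (s.rw x).rw y = s.rw (x * y) := by
  simp [rw, mul_assoc]

theorem lw_rw (x y : P.T) (s : P.SEdge) : (s.rw y).lw x = (s.lw x).rw y := rfl

end SEdge

/-- `IsPath a k b`: the list `k` of oriented edges is an edge path from `a` to `b`. -/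
def IsPath (a : P.T) : List P.SEdge → P.T → Prop
  | [], b => a = b
  | s :: k, b => s.dom = a ∧ IsPath s.cod k b

/-- Homotopy of edge paths from `a` to `b`: the congruence generated by cancellation of `s s⁻¹`
and by the `2`-cells. -/
inductive Hty : P.T → P.T → List P.SEdge → List P.SEdge → Prop
  | refl {a b : P.T} {k : List P.SEdge} : IsPath a k b → Hty a b k k
  | symm {a b : P.T} {k k' : List P.SEdge} : Hty a b k k' → Hty a b k' k
  | trans {a b : P.T} {k k' k'' : List P.SEdge} : Hty a b k k' → Hty a b k' k'' → Hty a b k k''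
  | append {a b c : P.T} {k k' j j' : List P.SEdge} :
      Hty a b k k' → Hty b c j j' → Hty a c (k ++ j) (k' ++ j')
  | cancel (s : P.SEdge) : Hty s.dom s.dom [s, s.inv] []
  | cell (p q p' q' : P.T) (s s' : P.rels) :
      Hty (p * P.ρτ s.1.1 * q * p' * P.ρτ s'.1.1 * q') (p * P.ρτ s.1.2 * q * p' * P.ρτ s'.1.2 * q')
        [⟨⟨p, s, q * p' * P.ρτ s'.1.1 * q'⟩, true⟩, ⟨⟨p * P.ρτ s.1.2 * q * p', s', q'⟩, true⟩]
        [⟨⟨p * P.ρτ s.1.1 * q * p', s', q'⟩, true⟩, ⟨⟨p, s, q * p' * P.ρτ s'.1.2 * q'⟩, true⟩]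

theorem IsPath.append {a b c : P.T} {k j : List P.SEdge} (h : IsPath a k b) (h' : IsPath b j c) :
    IsPath a (k ++ j) c := by
  induction k generalizing a with
  | nil => cases h; exact h'
  | cons s k ih => exact ⟨h.1, ih h.2⟩

theorem IsPath.lw {a b : P.T} {k : List P.SEdge} (x : P.T) (h : IsPath a k b) :
    IsPath (x * a) (k.map (SEdge.lw x)) (x * b) := by
  induction k generalizing a with
  | nil => exact congrArg (x * ·) h
  | cons s k ih => exact ⟨by rw [SEdge.dom_lw, h.1], by rw [SEdge.cod_lw]; exact ih h.2⟩

theorem IsPath.rw {a b : P.T} {k : List P.SEdge} (x : P.T) (h : IsPath a k b) :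
    IsPath (a * x) (k.map (SEdge.rw x)) (b * x) := by
  induction k generalizing a with
  | nil => exact congrArg (· * x) h
  | cons s k ih => exact ⟨by rw [SEdge.dom_rw, h.1], by rw [SEdge.cod_rw]; exact ih h.2⟩

theorem IsPath.reverse {a b : P.T} {k : List P.SEdge} (h : IsPath a k b) :
    IsPath b (k.map SEdge.inv).reverse a := by
  induction k generalizing a with
  | nil => exact Eq.symm h
  | cons s k ih =>
    rw [List.map_cons, List.reverse_cons]
    exact (ih h.2).append ⟨s.dom_inv, s.cod_inv.trans h.1⟩

theorem IsPath.ψ_eq {a b : P.T} {k : List P.SEdge} (h : IsPath a k b) : P.ψ a = P.ψ b := by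
  induction k generalizing a with
  | nil => exact congrArg _ h
  | cons s k ih =>
    rw [← ih h.2, ← h.1]
    obtain ⟨⟨p, s, q⟩, _ | _⟩ := s <;>
      simp [SEdge.dom, SEdge.cod, Edge.dom, Edge.cod, P.ψ_rel]

theorem Hty.lw {a b : P.T} {k j : List P.SEdge} (x : P.T) (h : Hty a b k j) :
    Hty (x * a) (x * b) (k.map (SEdge.lw x)) (j.map (SEdge.lw x)) := by
  induction h with
  | refl h => exact .refl (h.lw x)
  | symm _ ih => exact ih.symm
  | trans _ _ ih₁ ih₂ => exact ih₁.trans ih₂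
  | append _ _ ih₁ ih₂ => rw [List.map_append, List.map_append]; exact ih₁.append ih₂
  | cancel s => rw [← SEdge.dom_lw]; exact .cancel (s.lw x)
  | cell p q p' q' s s' =>
    have := Hty.cell (x * p) q p' q' s s'
    simp only [mul_assoc] at this
    simpa only [List.map_cons, List.map_nil, SEdge.lw, mul_assoc] using this

theorem Hty.rw {a b : P.T} {k j : List P.SEdge} (x : P.T) (h : Hty a b k j) :
    Hty (a * x) (b * x) (k.map (SEdge.rw x)) (j.map (SEdge.rw x)) := by
  induction h with
  | refl h => exact .refl (h.rw x)
  | symm _ ih => exact ih.symm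
  | trans _ _ ih₁ ih₂ => exact ih₁.trans ih₂
  | append _ _ ih₁ ih₂ => rw [List.map_append, List.map_append]; exact ih₁.append ih₂
  | cancel s => rw [← SEdge.dom_rw]; exact .cancel (s.rw x)
  | cell p q p' q' s s' =>
    have := Hty.cell p q p' (q' * x) s s'
    simp only [mul_assoc] at this
    simpa only [List.map_cons, List.map_nil, SEdge.rw, mul_assoc] using this

theorem Hty.reverse_left {a b : P.T} {k : List P.SEdge} (h : IsPath a k b) :
    Hty b b ((k.map SEdge.inv).reverse ++ k) [] := by
  induction k generalizing a with
  | nil => exact .refl rfl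
  | cons s k ih =>
    have hc : Hty s.cod s.cod [s.inv, s] [] := by
      have := Hty.cancel s.inv
      rwa [s.dom_inv, s.inv_inv] at this
    rw [List.map_cons, List.reverse_cons, List.append_assoc]
    have h₂ : Hty s.cod b ([s.inv, s] ++ k) ([] ++ k) := hc.append (.refl h.2)
    exact ((Hty.refl h.2.reverse).append h₂).trans (ih h.2)

theorem Hty.isPath {a b : P.T} {k j : List P.SEdge} (h : Hty a b k j) :
    IsPath a k b ∧ IsPath a j b := by
  induction h with
  | refl h => exact ⟨h, h⟩
  | symm _ ih => exact ih.symm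
  | trans _ _ ih₁ ih₂ => exact ⟨ih₁.1, ih₂.2⟩
  | append _ _ ih₁ ih₂ => exact ⟨ih₁.1.append ih₂.1, ih₁.2.append ih₂.2⟩
  | cancel s => exact ⟨⟨rfl, s.dom_inv, s.cod_inv⟩, rfl⟩
  | cell p q p' q' s s' =>
    simp [IsPath, SEdge.dom, SEdge.cod, Edge.dom, Edge.cod, mul_assoc]

theorem Hty.reverse {a b : P.T} {k j : List P.SEdge} (h : Hty a b k j) :
    Hty b a (k.map SEdge.inv).reverse (j.map SEdge.inv).reverse := by
  have hp := h.isPath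
  have h₁ : Hty b a ((j.map SEdge.inv).reverse ++ (j ++ (k.map SEdge.inv).reverse))
      (k.map SEdge.inv).reverse := by
    rw [← List.append_assoc]
    exact (Hty.reverse_left hp.2).append (.refl hp.1.reverse)
  have h₂ : Hty a a (k ++ (k.map SEdge.inv).reverse) [] := by
    have := Hty.reverse_left hp.1.reverse
    have hi : (SEdge.inv ∘ SEdge.inv : P.SEdge → P.SEdge) = id := funext SEdge.inv_inv
    rwa [List.map_reverse, List.reverse_reverse, List.map_map, hi, List.map_id] at this
  have h₃ : Hty a a (j ++ (k.map SEdge.inv).reverse) [] :=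
    (h.symm.append (.refl hp.1.reverse)).trans h₂
  have h₄ := (Hty.refl hp.2.reverse).append h₃
  rw [List.append_nil] at h₄
  exact h₁.symm.trans h₄

/-- The interchange property for two edges. -/
theorem Hty.edges (s t : P.SEdge) : Hty (s.dom * t.dom) (s.cod * t.cod)
    [s.rw t.dom, t.lw s.cod] [t.lw s.dom, s.rw t.cod] := by
  have base : ∀ s t : P.Edge, Hty (s.dom * t.dom) (s.cod * t.cod)
      [SEdge.rw t.dom ⟨s, true⟩, SEdge.lw s.cod ⟨t, true⟩]
      [SEdge.lw s.dom ⟨t, true⟩, SEdge.rw t.cod ⟨s, true⟩] := by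
    rintro ⟨p, s, q⟩ ⟨p', s', q'⟩
    have := Hty.cell p q p' q' s s'
    simp only [mul_assoc] at this
    simpa only [SEdge.rw, SEdge.lw, Edge.dom, Edge.cod, mul_assoc] using this
  have left : ∀ s t : P.SEdge, Hty (s.dom * t.dom) (s.cod * t.cod)
      [s.rw t.dom, t.lw s.cod] [t.lw s.dom, s.rw t.cod] →
      Hty (s.inv.dom * t.dom) (s.inv.cod * t.cod)
      [s.inv.rw t.dom, t.lw s.inv.cod] [t.lw s.inv.dom, s.inv.rw t.cod] := by
    intro s t h
    rw [s.dom_inv, s.cod_inv]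
    have e₁ : Hty (s.dom * t.cod) (s.dom * t.cod) [s.rw t.cod, s.inv.rw t.cod] [] :=
      (Hty.cancel s).rw t.cod
    have e₂ : Hty (s.cod * t.dom) (s.cod * t.dom) [s.inv.rw t.dom, s.rw t.dom] [] := by
      have := (Hty.cancel s.inv).rw t.dom
      rwa [s.dom_inv, s.inv_inv] at this
    have p₁ : IsPath (s.cod * t.dom) [s.inv.rw t.dom] (s.dom * t.dom) :=
      ⟨by rw [SEdge.dom_rw, s.dom_inv], by rw [SEdge.cod_rw, s.cod_inv]; rfl⟩
    have p₂ : IsPath (s.cod * t.cod) [s.inv.rw t.cod] (s.dom * t.cod) :=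
      ⟨by rw [SEdge.dom_rw, s.dom_inv], by rw [SEdge.cod_rw, s.cod_inv]; rfl⟩
    have p₃ : IsPath (s.dom * t.dom) [t.lw s.dom] (s.dom * t.cod) :=
      ⟨SEdge.dom_lw _ _, SEdge.cod_lw _ _⟩
    have p₄ : IsPath (s.cod * t.dom) [t.lw s.cod] (s.cod * t.cod) :=
      ⟨SEdge.dom_lw _ _, SEdge.cod_lw _ _⟩
    have m := ((Hty.refl p₁).append h).append (.refl p₂)
    have m₁ := ((Hty.refl p₁).append (.refl p₃)).append e₁
    have m₂ := e₂.append ((Hty.refl p₄).append (.refl p₂))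
    exact m₁.symm.trans (m.symm.trans m₂)
  have right : ∀ s t : P.SEdge, Hty (s.dom * t.dom) (s.cod * t.cod)
      [s.rw t.dom, t.lw s.cod] [t.lw s.dom, s.rw t.cod] →
      Hty (s.dom * t.inv.dom) (s.cod * t.inv.cod)
      [s.rw t.inv.dom, t.inv.lw s.cod] [t.inv.lw s.dom, s.rw t.inv.cod] := by
    intro s t h
    rw [t.dom_inv, t.cod_inv]
    have e₁ : Hty (s.cod * t.dom) (s.cod * t.dom) [t.lw s.cod, t.inv.lw s.cod] [] :=
      (Hty.cancel t).lw s.cod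
    have e₂ : Hty (s.dom * t.cod) (s.dom * t.cod) [t.inv.lw s.dom, t.lw s.dom] [] := by
      have := (Hty.cancel t.inv).lw s.dom
      rwa [t.dom_inv, t.inv_inv] at this
    have p₁ : IsPath (s.dom * t.cod) [t.inv.lw s.dom] (s.dom * t.dom) :=
      ⟨by rw [SEdge.dom_lw, t.dom_inv], by rw [SEdge.cod_lw, t.cod_inv]; rfl⟩
    have p₂ : IsPath (s.cod * t.cod) [t.inv.lw s.cod] (s.cod * t.dom) :=
      ⟨by rw [SEdge.dom_lw, t.dom_inv], by rw [SEdge.cod_lw, t.cod_inv]; rfl⟩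
    have p₃ : IsPath (s.dom * t.dom) [s.rw t.dom] (s.cod * t.dom) :=
      ⟨SEdge.dom_rw _ _, SEdge.cod_rw _ _⟩
    have p₄ : IsPath (s.dom * t.cod) [s.rw t.cod] (s.cod * t.cod) :=
      ⟨SEdge.dom_rw _ _, SEdge.cod_rw _ _⟩
    have m := ((Hty.refl p₁).append h).append (.refl p₂)
    have m₁ := ((Hty.refl p₁).append (.refl p₃)).append e₁
    have m₂ := e₂.append ((Hty.refl p₄).append (.refl p₂))
    exact m₂.symm.trans (m.symm.trans m₁)
  have fwd : ∀ (s : P.SEdge) (t : P.Edge), Hty (s.dom * t.dom) (s.cod * t.cod)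
      [s.rw t.dom, SEdge.lw s.cod ⟨t, true⟩] [SEdge.lw s.dom ⟨t, true⟩, s.rw t.cod] := by
    rintro ⟨s, _ | _⟩ t
    · exact left ⟨s, true⟩ ⟨t, true⟩ (base s t)
    · exact base s t
  obtain ⟨t, _ | _⟩ := t
  · exact right s ⟨t, true⟩ (fwd s t)
  · exact fwd s t

/-- The interchange property for two paths. -/
theorem Hty.interchange {a b c d : P.T} {k j : List P.SEdge} (hk : IsPath a k b)
    (hj : IsPath c j d) : Hty (a * c) (b * d)
      (k.map (SEdge.rw c) ++ j.map (SEdge.lw b)) (j.map (SEdge.lw a) ++ k.map (SEdge.rw d)) := by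
  have single : ∀ (s : P.SEdge) {c : P.T} {j : List P.SEdge}, IsPath c j d →
      Hty (s.dom * c) (s.cod * d) ([s.rw c] ++ j.map (SEdge.lw s.cod))
        (j.map (SEdge.lw s.dom) ++ [s.rw d]) := by
    intro s c j hj
    induction j generalizing c with
    | nil =>
      cases hj
      exact .refl ⟨SEdge.dom_rw _ _, SEdge.cod_rw _ _⟩
    | cons t j ih =>
      obtain ⟨rfl, hj⟩ := hj
      have h₁ : Hty (s.dom * t.dom) (s.cod * d)
          ([s.rw t.dom, t.lw s.cod] ++ j.map (SEdge.lw s.cod))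
          ([t.lw s.dom, s.rw t.cod] ++ j.map (SEdge.lw s.cod)) :=
        (Hty.edges s t).append (.refl (hj.lw s.cod))
      have p : IsPath (s.dom * t.dom) [t.lw s.dom] (s.dom * t.cod) :=
        ⟨SEdge.dom_lw _ _, SEdge.cod_lw _ _⟩
      exact h₁.trans ((Hty.refl p).append (ih hj))
  induction k generalizing a with
  | nil =>
    cases hk
    simpa using Hty.refl (hj.lw _)
  | cons s k ih =>
    obtain ⟨rfl, hk⟩ := hk
    have p : IsPath (s.dom * c) [s.rw c] (s.cod * c) := ⟨SEdge.dom_rw _ _, SEdge.cod_rw _ _⟩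
    have h₁ := (Hty.refl p).append (ih hk)
    have h₂ := (single s hj).append (.refl (hk.rw d))
    rw [List.append_assoc] at h₂
    rw [List.append_assoc] at h₂
    exact h₁.trans h₂

variable (P) in
/-- An edge path in the Squier complex, from the vertex `d` to the vertex `r`. -/
@[ext] structure EdgePath where
  d : P.T
  r : P.T
  edges : List P.SEdge
  isPath : IsPath d edges r

namespace EdgePath

/-- The constant path at a vertex. -/
def const (x : P.T) : P.EdgePath := ⟨x, x, [], rfl⟩

/-- The path consisting of a single edge. -/
def single (s : P.Edge) : P.EdgePath := ⟨s.dom, s.cod, [⟨s, true⟩], rfl, rfl⟩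

/-- Composition of paths. -/
def comp (α β : P.EdgePath) (h : α.r = β.d) : P.EdgePath :=
  ⟨α.d, β.r, α.edges ++ β.edges, α.isPath.append (h ▸ β.isPath)⟩

/-- The reverse path. -/
def symm (α : P.EdgePath) : P.EdgePath :=
  ⟨α.r, α.d, (α.edges.map SEdge.inv).reverse, α.isPath.reverse⟩

/-- The left action `x ▷ α`. -/
def lw (x : P.T) (α : P.EdgePath) : P.EdgePath :=
  ⟨x * α.d, x * α.r, α.edges.map (SEdge.lw x), α.isPath.lw x⟩

/-- The right action `α ◁ x`. -/
def rw (x : P.T) (α : P.EdgePath) : P.EdgePath :=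
  ⟨α.d * x, α.r * x, α.edges.map (SEdge.rw x), α.isPath.rw x⟩

/-- The operation `α ∗ β = (α ◁ β d) ∘ (α r ▷ β)`. -/
def star (α β : P.EdgePath) : P.EdgePath := comp (α.rw β.d) (β.lw α.r) rfl

/-- The operation `α ↦ (α r)⁻¹ ▷ α° ◁ (α d)⁻¹`, where `α°` is the reverse path. -/
def starInv (α : P.EdgePath) : P.EdgePath := (α.symm.rw α.d⁻¹).lw α.r⁻¹

/-- Homotopy of paths relative to the end points. -/
instance homotopy : Setoid P.EdgePath where
  r α β := α.d = β.d ∧ α.r = β.r ∧ Hty α.d α.r α.edges β.edges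
  iseqv :=
    { refl := fun α => ⟨rfl, rfl, .refl α.isPath⟩
      symm := fun {α β} ⟨h₁, h₂, h⟩ => ⟨h₁.symm, h₂.symm, by rw [← h₁, ← h₂]; exact h.symm⟩
      trans := fun {α β γ} ⟨h₁, h₂, h⟩ ⟨k₁, k₂, k⟩ =>
        ⟨h₁.trans k₁, h₂.trans k₂, h.trans (by rw [h₁, h₂]; exact k)⟩ }

theorem lw_congr (x : P.T) {α β : P.EdgePath} (h : α ≈ β) : α.lw x ≈ β.lw x :=
  ⟨congrArg (x * ·) h.1, congrArg (x * ·) h.2.1, h.2.2.lw x⟩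

theorem rw_congr (x : P.T) {α β : P.EdgePath} (h : α ≈ β) : α.rw x ≈ β.rw x :=
  ⟨congrArg (· * x) h.1, congrArg (· * x) h.2.1, h.2.2.rw x⟩

theorem comp_congr {α α' β β' : P.EdgePath} (h : α ≈ α') (k : β ≈ β') (e : α.r = β.d)
    (e' : α'.r = β'.d) : comp α β e ≈ comp α' β' e' :=
  ⟨h.1, k.2.1, h.2.2.append (by rw [e]; exact k.2.2)⟩

theorem symm_congr {α β : P.EdgePath} (h : α ≈ β) : α.symm ≈ β.symm :=
  ⟨h.2.1, h.1, h.2.2.reverse⟩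

theorem star_congr {α α' β β' : P.EdgePath} (h : α ≈ α') (k : β ≈ β') :
    star α β ≈ star α' β' := by
  have h₁ := rw_congr β.d h
  have k₁ := lw_congr α.r k
  rw [show α'.rw β.d = α'.rw β'.d by rw [k.1]] at h₁
  rw [show β'.lw α.r = β'.lw α'.r by rw [h.2.1]] at k₁
  exact comp_congr h₁ k₁ _ _

theorem starInv_congr {α β : P.EdgePath} (h : α ≈ β) : starInv α ≈ starInv β := by
  unfold starInv
  rw [h.1, h.2.1]
  exact lw_congr _ (rw_congr _ (symm_congr h))

theorem lw_lw (x y : P.T) (α : P.EdgePath) : (α.lw y).lw x = α.lw (x * y) := by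
  ext1
  · exact (mul_assoc x y α.d).symm
  · exact (mul_assoc x y α.r).symm
  · simp [lw, Function.comp_def, SEdge.lw_lw]

theorem rw_rw (x y : P.T) (α : P.EdgePath) : (α.rw x).rw y = α.rw (x * y) := by
  ext1
  · exact mul_assoc α.d x y
  · exact mul_assoc α.r x y
  · simp [rw, Function.comp_def, SEdge.rw_rw]

theorem lw_rw (x y : P.T) (α : P.EdgePath) : (α.rw y).lw x = (α.lw x).rw y := by
  ext1
  · exact (mul_assoc x α.d y).symm
  · exact (mul_assoc x α.r y).symm
  · simp [rw, lw, Function.comp_def, SEdge.lw_rw]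

theorem star_assoc (α β γ : P.EdgePath) : star (star α β) γ = star α (star β γ) := by
  ext1
  · exact mul_assoc α.d β.d γ.d
  · exact mul_assoc α.r β.r γ.r
  · simp [star, comp, rw, lw, Function.comp_def, SEdge.rw_rw, SEdge.lw_lw, SEdge.lw_rw]

theorem lw_star (x : P.T) (α β : P.EdgePath) : (star α β).lw x = star (α.lw x) β := by
  ext1
  · exact (mul_assoc x α.d β.d).symm
  · exact (mul_assoc x α.r β.r).symm
  · simp [star, comp, rw, lw, Function.comp_def, SEdge.lw_lw, SEdge.lw_rw]

theorem rw_star (x : P.T) (α β : P.EdgePath) : (star α β).rw x = star α (β.rw x) := by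
  ext1
  · exact mul_assoc α.d β.d x
  · exact mul_assoc α.r β.r x
  · simp [star, comp, rw, lw, Function.comp_def, SEdge.rw_rw, SEdge.lw_rw]

/-- Path-level form of membership in `star_e^⋈`. -/
structure Adapted (e : Idem P.T) (α : P.EdgePath) : Prop where
  d_eq : α.d = e.val
  lw_eq : α.lw e.val = α
  rw_eq : α.rw e.val = α

namespace Adapted

variable {e f : Idem P.T} {α β : P.EdgePath}

theorem r_mem (h : Adapted e α) : α.r * α.r⁻¹ = e.val ∧ α.r⁻¹ * α.r = e.val :=
  P.ψ_ker e.idem (by rw [← α.isPath.ψ_eq, h.d_eq])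

theorem mul_r (h : Adapted e α) : e.val * α.r = α.r := congrArg EdgePath.r h.lw_eq

theorem r_mul (h : Adapted e α) : α.r * e.val = α.r := congrArg EdgePath.r h.rw_eq

theorem mul_inv (h : Adapted e α) : e.val * α.r⁻¹ = α.r⁻¹ := by
  rw [← h.r_mem.2, inv_mul_inv]

theorem inv_mul (h : Adapted e α) : α.r⁻¹ * e.val = α.r⁻¹ := by
  rw [← h.r_mem.1, ← mul_assoc, inv_mul_inv]

theorem const (e : Idem P.T) : Adapted e (const e.val) :=
  ⟨rfl, EdgePath.ext e.idem e.idem rfl, EdgePath.ext e.idem e.idem rfl⟩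

theorem star (h : Adapted e α) (k : Adapted e β) : Adapted e (star α β) :=
  ⟨by
    change α.d * β.d = _
    rw [h.d_eq, k.d_eq, e.idem], by rw [lw_star, h.lw_eq], by rw [rw_star, k.rw_eq]⟩

theorem starInv_eq (h : Adapted e α) : α.starInv = (α.symm.rw e.val).lw α.r⁻¹ := by
  rw [starInv, h.d_eq, idem_inv e.idem]

theorem starInv (h : Adapted e α) : Adapted e α.starInv := by
  rw [h.starInv_eq]
  refine ⟨?_, ?_, ?_⟩
  · change α.r⁻¹ * (α.r * e.val) = _
    rw [h.r_mul, h.r_mem.2]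
  · rw [lw_lw, h.mul_inv]
  · rw [← lw_rw, rw_rw, e.idem]

theorem conj (h : Adapted e α) (g : Arrow e f) : Adapted f ((α.rw g.val).lw g.val⁻¹) := by
  refine ⟨?_, ?_, ?_⟩
  · change g.val⁻¹ * (α.d * g.val) = _
    rw [h.d_eq, g.dom_mul, g.cod]
  · rw [lw_lw, ← g.cod, inv_mul_inv]
  · rw [← lw_rw, rw_rw, g.mul_cod]

theorem const_star (h : Adapted e α) : EdgePath.star (EdgePath.const e.val) α = α :=
  Eq.trans (EdgePath.ext rfl rfl rfl) h.lw_eq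

theorem star_const (h : Adapted e α) : EdgePath.star α (EdgePath.const e.val) = α := by
  have h₁ : EdgePath.star α (EdgePath.const e.val) = α.rw e.val :=
    EdgePath.ext rfl rfl (List.append_nil _)
  rw [h₁, h.rw_eq]

theorem starInv_star (h : Adapted e α) : EdgePath.star α.starInv α ≈ EdgePath.const e.val := by
  have h₁ : EdgePath.star α.starInv α = (comp α.symm α rfl).lw α.r⁻¹ := by
    have hs : α.symm.rw e.val = α.symm := by
      conv_rhs => rw [← h.rw_eq]
      ext1
      · rfl
      · rfl
      · simp [symm, rw, SEdge.rw, SEdge.inv, Function.comp_def]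
    have hr : α.starInv.r = α.r⁻¹ := by
      rw [h.starInv_eq]
      change α.r⁻¹ * (α.d * e.val) = _
      rw [h.d_eq, e.idem, h.inv_mul]
    have h₂ : α.starInv.rw α.d = α.symm.lw α.r⁻¹ := by
      rw [h.d_eq, h.starInv.rw_eq, h.starInv_eq, hs]
    ext1
    · exact (congrArg EdgePath.d h₂ :)
    · change α.starInv.r * α.r = _
      rw [hr]
      rfl
    · change (α.starInv.rw α.d).edges ++ (α.lw α.starInv.r).edges = _
      rw [h₂, hr]
      simp [lw, comp]
  rw [h₁]
  have h₃ : comp α.symm α rfl ≈ EdgePath.const α.r := ⟨rfl, rfl, Hty.reverse_left α.isPath⟩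
  have h₄ : (EdgePath.const α.r).lw α.r⁻¹ = EdgePath.const e.val :=
    EdgePath.ext h.r_mem.2 h.r_mem.2 rfl
  rw [← h₄]
  exact lw_congr _ h₃

theorem conj_star (h : Adapted e α) (g : Arrow e f) :
    ((EdgePath.star α β).rw g.val).lw g.val⁻¹ =
      EdgePath.star ((α.rw g.val).lw g.val⁻¹) ((β.rw g.val).lw g.val⁻¹) := by
  rw [rw_star]
  have hg : g.val * g.val⁻¹ = e.val := g.dom
  have h₀ : EdgePath.star α (β.rw g.val) = EdgePath.star (α.rw g.val) ((β.rw g.val).lw g.val⁻¹) := by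
    have hd : (α.rw g.val).rw (g.val⁻¹ * (β.d * g.val)) = α.rw (β.d * g.val) := by
      rw [rw_rw, ← mul_assoc, hg, ← rw_rw, h.rw_eq]
    have hr : α.r * g.val * g.val⁻¹ = α.r := by rw [mul_assoc, hg, h.r_mul]
    have hl : ((β.rw g.val).lw g.val⁻¹).lw (α.r * g.val) = (β.rw g.val).lw α.r := by
      rw [lw_lw, hr]
    ext1
    · exact (congrArg EdgePath.d hd).symm
    · exact (congrArg EdgePath.r hl).symm
    · exact (congrArg₂ (· ++ ·) (congrArg EdgePath.edges hd) (congrArg EdgePath.edges hl)).symm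
  rw [h₀, lw_star]

theorem peiffer (h : Adapted e α) (k : Adapted e β) :
    EdgePath.star β α ≈ EdgePath.star α ((β.rw α.r).lw α.r⁻¹) := by
  have h₁ : EdgePath.star α ((β.rw α.r).lw α.r⁻¹) =
      comp (α.lw β.d) (β.rw α.r) (by
        change β.d * α.r = β.d * α.r
        rfl) := by
    have hl : ((β.rw α.r).lw α.r⁻¹).lw α.r = β.rw α.r := by
      rw [lw_lw, h.r_mem.1, lw_rw, k.lw_eq]
    have hd : α.rw (α.r⁻¹ * (β.d * α.r)) = α.lw β.d := by
      rw [k.d_eq, h.mul_r, h.r_mem.2, h.rw_eq, h.lw_eq]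
    ext1
    · exact (congrArg EdgePath.d hd :)
    · exact (congrArg EdgePath.r hl :)
    · exact congrArg₂ (· ++ ·) (congrArg EdgePath.edges hd) (congrArg EdgePath.edges hl)
  rw [h₁]
  exact ⟨rfl, rfl, Hty.interchange β.isPath α.isPath⟩

end Adapted

end EdgePath

variable (P) in
/-- The arrows of the fundamental groupoid `π(Sq(P), 𝒯)`. -/
def Pi1 : Type u := Quotient (EdgePath.homotopy (P := P))

namespace Pi1

/-- The homotopy class of a path. -/
def mk (α : P.EdgePath) : P.Pi1 := Quotient.mk _ α

def d : P.Pi1 → P.T := Quotient.lift EdgePath.d fun _ _ h => h.1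

def r : P.Pi1 → P.T := Quotient.lift EdgePath.r fun _ _ h => h.2.1

def lw (x : P.T) : P.Pi1 → P.Pi1 := Quotient.map (EdgePath.lw x) fun _ _ h => EdgePath.lw_congr x h

def rw (x : P.T) : P.Pi1 → P.Pi1 := Quotient.map (EdgePath.rw x) fun _ _ h => EdgePath.rw_congr x h

def star : P.Pi1 → P.Pi1 → P.Pi1 :=
  Quotient.map₂ EdgePath.star fun _ _ h _ _ k => EdgePath.star_congr h k

def starInv : P.Pi1 → P.Pi1 :=
  Quotient.map EdgePath.starInv fun _ _ h => EdgePath.starInv_congr h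

end Pi1

/-- The set `star_e^⋈ = {e ▷ β ◁ e : β d = e}`. -/
def StarBow (e : Idem P.T) : Type u :=
  {α : P.Pi1 // ∃ β : P.Pi1, β.d = e.val ∧ α = (β.rw e.val).lw e.val}

namespace StarBow

variable {e f : Idem P.T}

theorem mem_of_adapted {α : P.EdgePath} (h : EdgePath.Adapted e α) :
    ∃ β : P.Pi1, β.d = e.val ∧ Pi1.mk α = (β.rw e.val).lw e.val :=
  ⟨Pi1.mk α, h.d_eq, congrArg Pi1.mk (by rw [h.rw_eq, h.lw_eq])⟩

theorem exists_adapted (α : StarBow e) :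
    ∃ a : P.EdgePath, EdgePath.Adapted e a ∧ Pi1.mk a = α.1 := by
  obtain ⟨_, ⟨⟨b⟩, hd, rfl⟩⟩ := α
  have hd' : b.d = e.val := hd
  refine ⟨(b.rw e.val).lw e.val, ⟨?_, ?_, ?_⟩, rfl⟩
  · change e.val * (b.d * e.val) = _
    rw [hd', e.idem, e.idem]
  · rw [EdgePath.lw_lw, e.idem]
  · rw [← EdgePath.lw_rw, EdgePath.rw_rw, e.idem]

/-- The group `(star_e^⋈, ∗)`. -/
instance group (e : Idem P.T) : Group (StarBow e) where
  mul α β := ⟨Pi1.star α.1 β.1, by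
    obtain ⟨a, ha, ha'⟩ := α.exists_adapted
    obtain ⟨b, hb, hb'⟩ := β.exists_adapted
    rw [← ha', ← hb']
    exact mem_of_adapted (ha.star hb)⟩
  one := ⟨Pi1.mk (EdgePath.const e.val), mem_of_adapted (.const e)⟩
  inv α := ⟨Pi1.starInv α.1, by
    obtain ⟨a, ha, ha'⟩ := α.exists_adapted
    rw [← ha']
    exact mem_of_adapted ha.starInv⟩
  mul_assoc := by
    rintro ⟨⟨a⟩, _⟩ ⟨⟨b⟩, _⟩ ⟨⟨c⟩, _⟩
    exact Subtype.ext (congrArg Pi1.mk (EdgePath.star_assoc a b c))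
  one_mul α := by
    obtain ⟨a, ha, ha'⟩ := α.exists_adapted
    refine Subtype.ext ?_
    change Pi1.star (Pi1.mk (EdgePath.const e.val)) α.1 = α.1
    rw [← ha']
    exact congrArg Pi1.mk ha.const_star
  mul_one α := by
    obtain ⟨a, ha, ha'⟩ := α.exists_adapted
    refine Subtype.ext ?_
    change Pi1.star α.1 (Pi1.mk (EdgePath.const e.val)) = α.1
    rw [← ha']
    exact congrArg Pi1.mk ha.star_const
  inv_mul_cancel α := by
    obtain ⟨a, ha, ha'⟩ := α.exists_adapted
    refine Subtype.ext ?_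
    change Pi1.star (Pi1.starInv α.1) α.1 = Pi1.mk (EdgePath.const e.val)
    rw [← ha']
    exact Quotient.sound ha.starInv_star

/-- The range map `star_e^⋈ → 𝒯`, which takes values in the vertex group at `e`. -/
def bd (e : Idem P.T) : StarBow e →* (e ⟶ e) where
  toFun α := (⟨α.1.r, by
      obtain ⟨a, ha, ha'⟩ := α.exists_adapted
      rw [← ha']
      exact ha.r_mem.1, by
      obtain ⟨a, ha, ha'⟩ := α.exists_adapted
      rw [← ha']
      exact ha.r_mem.2⟩ : Arrow e e)
  map_one' := rfl
  map_mul' := by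
    rintro ⟨⟨a⟩, _⟩ ⟨⟨b⟩, _⟩
    rfl

/-- The action `α^g = g⁻¹ ▷ α ◁ g`. -/
def act (g : e ⟶ f) : StarBow e →* StarBow f :=
  MonoidHom.mk' (fun α => ⟨(α.1.rw (Arrow.val g)).lw (Arrow.val g)⁻¹, by
      obtain ⟨a, ha, ha'⟩ := α.exists_adapted
      rw [← ha']
      exact mem_of_adapted (ha.conj g)⟩) (by
    intro α β
    obtain ⟨a, ha, ha'⟩ := α.exists_adapted
    obtain ⟨b, hb, hb'⟩ := β.exists_adapted
    refine Subtype.ext ?_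
    change ((Pi1.star α.1 β.1).rw _).lw _ = Pi1.star ((α.1.rw _).lw _) ((β.1.rw _).lw _)
    rw [← ha', ← hb']
    exact congrArg Pi1.mk (ha.conj_star g))

end StarBow

variable (P) in
/-- The crossed module `S^⋈ → 𝒯 ⇉ E(𝒯)`. -/
def starCM : CrossedModule.{u, u, u} (Idem P.T) where
  C e := StarBow e
  bd e := StarBow.bd e
  act g := StarBow.act g
  act_id e α := by
    obtain ⟨a, ha, ha'⟩ := α.exists_adapted
    refine Subtype.ext ?_
    change (α.1.rw e.val).lw e.val⁻¹ = α.1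
    rw [← ha', idem_inv e.idem]
    exact congrArg Pi1.mk (by rw [ha.rw_eq, ha.lw_eq])
  act_comp g h α := by
    obtain ⟨a, ha, ha'⟩ := α.exists_adapted
    refine Subtype.ext ?_
    change (α.1.rw (Arrow.val g * Arrow.val h)).lw (Arrow.val g * Arrow.val h)⁻¹ =
      (((α.1.rw (Arrow.val g)).lw (Arrow.val g)⁻¹).rw (Arrow.val h)).lw (Arrow.val h)⁻¹
    rw [← ha', mul_inv']
    refine congrArg Pi1.mk ?_
    rw [← EdgePath.lw_rw, EdgePath.rw_rw, EdgePath.lw_lw]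
  bd_act g α := by
    obtain ⟨⟨a⟩, _⟩ := α
    rfl
  act_bd {e} α β := by
    rw [mul_assoc, eq_inv_mul_iff_mul_eq]
    obtain ⟨a, ha, ha'⟩ := α.exists_adapted
    obtain ⟨b, hb, hb'⟩ := β.exists_adapted
    refine Subtype.ext ?_
    change Pi1.star α.1 ((β.1.rw α.1.r).lw α.1.r⁻¹) = Pi1.star β.1 α.1
    rw [← ha', ← hb']
    exact (Quotient.sound (ha.peiffer hb)).symm

/-! #### The basis -/

variable (P) in
/-- The set `R` of triples `(l, r, x)` with `(l, r)` a relation and `x` an idempotent of `𝒯` such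
that `(l⁻¹ r) ρ τ ψ ≥ x ψ`. -/
structure Basis where
  rel : P.rels
  x : Idem P.T
  le : NatLE (P.ψ x.val) (P.ψ (P.ρτ (wordInv rel.1.1 * rel.1.2)))

/-- The loop `(l, r, x) ω = x ((l⁻¹ r) ρ τ) x` at `x`. -/
def ω (s : P.Basis) : s.x ⟶ s.x :=
  have h : P.ψ (s.x.val * P.ρτ (wordInv s.rel.1.1 * s.rel.1.2) * s.x.val) = P.ψ s.x.val := by
    obtain ⟨f, hf, h⟩ := s.le
    have hm : P.ψ (P.ρτ (wordInv s.rel.1.1 * s.rel.1.2)) =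
        (P.ψ (P.ρτ s.rel.1.1))⁻¹ * P.ψ (P.ρτ s.rel.1.1) := by
      rw [map_mul, map_mul, ← P.ψ_rel, P.ρτ_wordInv, map_inv']
    have hi := idem_inv_mul (P.ψ (P.ρτ s.rel.1.1))
    rw [← hm] at hi
    rw [map_mul, map_mul, mul_assoc]
    nth_rewrite 2 [h]
    rw [← mul_assoc (P.ψ (P.ρτ _)), hi, ← h, ← map_mul, s.x.idem]
  (⟨s.x.val * P.ρτ (wordInv s.rel.1.1 * s.rel.1.2) * s.x.val,
    (P.ψ_ker s.x.idem h).1, (P.ψ_ker s.x.idem h).2⟩ : Arrow s.x s.x)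

variable (P) in
/-- The free crossed `𝒯`-module with basis `ω`, as constructed from free groups. -/
def freeCM : CrossedModule.{u, u, u} (Idem P.T) := CrossedModule.free Basis.x (ω (P := P))

/-- The basis elements of the free crossed `𝒯`-module. -/
def freeCMBasis (s : P.Basis) : P.freeCM.C s.x := CrossedModule.freeBasis Basis.x ω s

/-- The class in `π(Sq(P), 𝒯)` of the edge `(x h⁻¹, l, r, x)`, where `h = l ρ τ`. -/
def basisEdge (s : P.Basis) : P.Pi1 :=
  Pi1.mk (EdgePath.single ⟨s.x.val * (P.ρτ s.rel.1.1)⁻¹, s.rel, s.x.val⟩)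

end InvPresentation

end Presentation

/-! ### The universal property of the free crossed module. -/

namespace CrossedModule

universe w₂

variable {V : Type u} [Groupoid.{v} V] {R : Type w} (b : R → V) (ω : ∀ r, b r ⟶ b r)

/-! Freeness is formal. A choice of images of the basis extends to the free groups by sending `(r,
g)` to the `g`-translate of the image of `r`, and the Peiffer elements die because the target
satisfies the second crossed module axiom (`free_isFreeOn`). The basis edges have boundary `ω`, so
freeness yields a morphism `toStar` to the star crossed module. The real content is an inverse to
it.

Throughout, `ψ` is injective on idempotents (`ψ_idem`). Relations become equalities in `M`, so `ψ`
is constant along edge paths. If one vertex of a path has the same image as `e`, then so has every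
vertex `v`, and `v v⁻¹ = e = v⁻¹ v` (`ψ_ker`).

The inverse reads an element of `C_e` off a path of this kind. The edge `(p, l, r, q)` contributes
the generator `((l, r, x), q e)` with `x = (q e)(q e)⁻¹`, a reversed edge contributes the inverse,
and the contributions are multiplied in order. The generator exists by `liftable_of_ψ`. The left
coordinate `p` can be ignored because, after translation to start at `e`, it is determined by the
rest of the edge. A 2-cell becomes exactly the Peiffer identity `E E' = E' E^{∂E'}`
(`edgeVal_interchange`), so the value depends only on the homotopy class (`pathVal_eq_of_hty`).

One composite is the identity by a check on generators (`starVal_toStar`). For the other,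
`toStar_pathVal` shows that the value of a path `α` starting at `a` is sent to the class of `a⁻¹ ▷ α
◁ e`. When `α` represents an element of the star group at `e`, this is `α` itself. -/

/-- The homomorphism on the free pre-crossed module induced by a choice of images of the basis. -/
def freeGroupLift (B : CrossedModule.{u, v, w₂} V) (σ : ∀ r, B.C (b r)) (e : V) :
    FreeGroup (FreeGen b e) →* B.C e :=
  FreeGroup.lift fun s => B.act s.snd (σ s.fst)

theorem freeGroupLift_of (B : CrossedModule.{u, v, w₂} V) (σ : ∀ r, B.C (b r)) (e : V)
    (s : FreeGen b e) : freeGroupLift b B σ e (FreeGroup.of s) = B.act s.snd (σ s.fst) :=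
  FreeGroup.lift_apply_of

theorem bd_freeGroupLift (B : CrossedModule.{u, v, w₂} V) (σ : ∀ r, B.C (b r))
    (hσ : ∀ r, B.bd (b r) (σ r) = ω r) (e : V) (x : FreeGroup (FreeGen b e)) :
    B.bd e (freeGroupLift b B σ e x) = freeBd b ω e x := by
  have : (B.bd e).comp (freeGroupLift b B σ e) = freeBd b ω e := by
    apply FreeGroup.ext_hom
    intro s
    rw [MonoidHom.comp_apply, freeGroupLift_of, B.bd_act, hσ, freeBd_of]
  exact DFunLike.congr_fun this x

theorem freeGroupLift_act (B : CrossedModule.{u, v, w₂} V) (σ : ∀ r, B.C (b r)) {e f : V}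
    (g : e ⟶ f) (x : FreeGroup (FreeGen b e)) :
    freeGroupLift b B σ f (freeAct b g x) = B.act g (freeGroupLift b B σ e x) := by
  have : (freeGroupLift b B σ f).comp (freeAct b g) = (B.act g).comp (freeGroupLift b B σ e) := by
    apply FreeGroup.ext_hom
    intro s
    rw [MonoidHom.comp_apply, freeAct_of, freeGroupLift_of, MonoidHom.comp_apply,
      freeGroupLift_of, B.act_comp]
  exact DFunLike.congr_fun this x

/-- The morphism out of the free crossed module induced by a choice of images of the basis. -/
def freeLift (B : CrossedModule.{u, v, w₂} V) (σ : ∀ r, B.C (b r))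
    (hσ : ∀ r, B.bd (b r) (σ r) = ω r) : Hom (free b ω) B where
  map e := QuotientGroup.lift (peiffer b ω e) (freeGroupLift b B σ e) (by
    refine (Subgroup.closure_le (MonoidHom.ker (freeGroupLift b B σ e))).2 ?_
    rintro _ ⟨u, v, rfl⟩
    -- The boundary in the free group is rewritten as the boundary in `B`, where acting by a
    -- boundary is conjugation, so the Peiffer element becomes `u⁻¹ v⁻¹ u (u⁻¹ v u) = 1`.
    rw [SetLike.mem_coe, MonoidHom.mem_ker, map_mul, freeGroupLift_act,
      ← bd_freeGroupLift b ω B σ hσ, B.act_bd, map_mul, map_mul, map_inv, map_inv]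
    group)
  bd_map e := by
    rintro ⟨x⟩
    exact bd_freeGroupLift b ω B σ hσ e x
  act_map g := by
    rintro ⟨x⟩
    exact freeGroupLift_act b B σ g x

theorem freeLift_mk_of (B : CrossedModule.{u, v, w₂} V) (σ : ∀ r, B.C (b r))
    (hσ : ∀ r, B.bd (b r) (σ r) = ω r) {e : V} (s : FreeGen b e) :
    (freeLift b ω B σ hσ).map e (QuotientGroup.mk' (peiffer b ω e) (FreeGroup.of s)) =
      B.act s.snd (σ s.fst) :=
  freeGroupLift_of b B σ e s

theorem freeLift_freeBasis (B : CrossedModule.{u, v, w₂} V) (σ : ∀ r, B.C (b r))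
    (hσ : ∀ r, B.bd (b r) (σ r) = ω r) (r : R) :
    (freeLift b ω B σ hσ).map (b r) (freeBasis b ω r) = σ r :=
  (freeLift_mk_of b ω B σ hσ _).trans (B.act_id _ _)

/-- Every generator is a translate of a basis element; hence a morphism, which respects the action,
is determined by its values on the basis. -/
theorem act_freeBasis {e : V} (s : FreeGen b e) :
    (free b ω).act s.snd (freeBasis b ω s.fst) =
      QuotientGroup.mk' (peiffer b ω e) (FreeGroup.of s) := by
  change QuotientGroup.mk' (peiffer b ω e) (freeAct b s.snd (FreeGroup.of _)) = _
  rw [freeAct_of, Category.id_comp]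

theorem free_isFreeOn : IsFreeOn.{u, v, w, max v w, w₂} (free b ω) b ω (freeBasis b ω) := by
  refine ⟨fun r => ?_, fun B σ hσ => ⟨freeLift b ω B σ hσ, freeLift_freeBasis b ω B σ hσ, ?_⟩⟩
  · refine (freeBd_of b ω (b r) ⟨r, 𝟙 (b r)⟩).trans ?_
    simp [Groupoid.inv_eq_inv]
  · intro φ hφ
    refine Hom.ext (funext fun e => ?_)
    refine QuotientGroup.monoidHom_ext _ (FreeGroup.ext_hom _ _ fun s => ?_)
    change φ.map e (QuotientGroup.mk' (peiffer b ω e) (FreeGroup.of s)) =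
      (freeLift b ω B σ hσ).map e (QuotientGroup.mk' (peiffer b ω e) (FreeGroup.of s))
    rw [freeLift_mk_of, ← act_freeBasis, φ.act_map, hφ]

end CrossedModule

/-! ### Comparing idempotents in an inverse monoid. -/

namespace InverseMonoid

variable {S : Type u} [InverseMonoid S]

/-- Idempotents commute, so `f c = f (c c⁻¹) c = c (c⁻¹ f c)`. -/
theorem idem_mul_of_conj {f c : S} (hf : f * f = f) (h : c⁻¹ * f * c = c⁻¹ * c) : f * c = c := by
  calc f * c = f * (c * c⁻¹) * c := by rw [mul_assoc f, mul_inv_mul]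
    _ = c * (c⁻¹ * f * c) := by rw [idem_comm hf (idem_mul_inv c)]; simp only [mul_assoc]
    _ = c := by rw [h, ← mul_assoc, mul_inv_mul]

/-- A right factor `c` of `a` with `c = c (a⁻¹ a)` has the same right idempotent as `a`. -/
theorem inv_mul_of_right_factor {e a p c : S} (he : e * e = e) (ha : a⁻¹ * a = e) (hp : a = p * c)
    (hc : c * e = c) : c⁻¹ * c = e := by
  -- Here `a c⁻¹ c = a` gives `e ≤ c⁻¹ c`; the hypothesis `hc` supplies the opposite inequality.
  have h₁ : e * (c⁻¹ * c) = e := by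
    rw [← ha, mul_assoc]
    congr 1
    rw [hp, mul_assoc, ← mul_assoc c, mul_inv_mul]
  rw [← h₁, idem_comm he (idem_inv_mul c), mul_assoc, hc]

end InverseMonoid

section Presentation

open InverseMonoid

/-! ### Transferring order conditions between `M` and `𝒯`. -/

namespace InvPresentation

variable {X : Type u} {M : Type v} [InverseMonoid M] {P : InvPresentation X M}

/-- The conclusion amounts to `a a⁻¹ ≤ f`, an equation between idempotents, and can therefore be
tested after applying `ψ`. -/
theorem idem_mul_eq_of_ψ {f a : P.T} (hf : f * f = f) (h : P.ψ (f * a) = P.ψ a) : f * a = a := by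
  have h₁ : f * (a * a⁻¹) = a * a⁻¹ := by
    apply P.ψ_idem (idem_mul hf (idem_mul_inv a)) (idem_mul_inv a)
    rw [← mul_assoc, map_mul, h, ← map_mul]
  calc f * a = f * (a * a⁻¹) * a := by rw [mul_assoc f, mul_inv_mul]
    _ = a := by rw [h₁, mul_inv_mul]

theorem ψ_inv_mul_rel (s : P.rels) : P.ψ (P.ρτ (wordInv s.1.1 * s.1.2)) =
    P.ψ ((P.ρτ s.1.1)⁻¹ * P.ρτ s.1.1) := by
  rw [map_mul, map_mul, ← P.ψ_rel, P.ρτ_wordInv, ← map_mul]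

/-- With `h = l ρ τ`, the elements `l⁻¹ r` and `h⁻¹ h` agree in `M`. The order condition on a basis
triple is thus `x ≤ h⁻¹ h` in `𝒯`, the form used from here on; `natLE_of_inv_mul_mul` is the
converse. -/
theorem Basis.inv_mul_mul (s : P.Basis) :
    (P.ρτ s.rel.1.1)⁻¹ * P.ρτ s.rel.1.1 * s.x.val = s.x.val := by
  apply idem_mul_eq_of_ψ (idem_inv_mul _)
  obtain ⟨f, -, h⟩ := s.le
  rw [ψ_inv_mul_rel] at h
  rw [map_mul, h, ← mul_assoc, ← map_mul, idem_inv_mul]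

theorem natLE_of_inv_mul_mul {s : P.rels} {x : P.T} (hx : x * x = x)
    (h : (P.ρτ s.1.1)⁻¹ * P.ρτ s.1.1 * x = x) :
    NatLE (P.ψ x) (P.ψ (P.ρτ (wordInv s.1.1 * s.1.2))) :=
  ⟨P.ψ x, by rw [← map_mul, hx], by rw [ψ_inv_mul_rel, ← map_mul, h]⟩

/-! #### The map from the free crossed module -/

theorem basisEdge_adapted (s : P.Basis) : EdgePath.Adapted s.x
    (EdgePath.single ⟨s.x.val * (P.ρτ s.rel.1.1)⁻¹, s.rel, s.x.val⟩) := by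
  -- The edge starts at `x h⁻¹ h x`, which is `x` exactly because `x ≤ h⁻¹ h`.
  have hd : s.x.val * (P.ρτ s.rel.1.1)⁻¹ * P.ρτ s.rel.1.1 * s.x.val = s.x.val := by
    rw [mul_assoc s.x.val, mul_assoc, s.inv_mul_mul, s.x.idem]
  have hx := s.x.idem
  refine ⟨hd, ?_, ?_⟩
  · ext1
    · change s.x.val * (s.x.val * (P.ρτ s.rel.1.1)⁻¹ * P.ρτ s.rel.1.1 * s.x.val) = _
      simp only [← mul_assoc, hx]
      rfl
    · change s.x.val * (s.x.val * (P.ρτ s.rel.1.1)⁻¹ * P.ρτ s.rel.1.2 * s.x.val) = _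
      simp only [← mul_assoc, hx]
      rfl
    · simp [EdgePath.lw, EdgePath.single, SEdge.lw, ← mul_assoc, hx]
  · ext1
    · change s.x.val * (P.ρτ s.rel.1.1)⁻¹ * P.ρτ s.rel.1.1 * s.x.val * s.x.val = _
      rw [mul_assoc, hx]
      rfl
    · change s.x.val * (P.ρτ s.rel.1.1)⁻¹ * P.ρτ s.rel.1.2 * s.x.val * s.x.val = _
      rw [mul_assoc, hx]
      rfl
    · simp [EdgePath.rw, EdgePath.single, SEdge.rw, hx]

/-- The class of the edge `(x h⁻¹, l, r, x)` as an element of `star_x^⋈`. -/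
def basisStar (s : P.Basis) : P.starCM.C s.x :=
  (⟨basisEdge s, StarBow.mem_of_adapted (basisEdge_adapted s)⟩ : StarBow s.x)

theorem bd_basisStar (s : P.Basis) : P.starCM.bd s.x (basisStar s) = ω s := by
  refine Arrow.ext ?_
  change s.x.val * (P.ρτ s.rel.1.1)⁻¹ * P.ρτ s.rel.1.2 * s.x.val =
    s.x.val * P.ρτ (wordInv s.rel.1.1 * s.rel.1.2) * s.x.val
  rw [map_mul, P.ρτ_wordInv, ← mul_assoc]

variable (P) in
/-- The morphism from the free crossed module to `S^⋈` induced by the basis edges. -/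
def toStar : CrossedModule.Hom P.freeCM P.starCM :=
  CrossedModule.freeLift Basis.x ω P.starCM basisStar bd_basisStar

/-! #### The value of a path in the free crossed module -/

/-- The base idempotent of a generator is recovered from its arrow as `g g⁻¹`, so generators can be
compared through elements of `𝒯` without transporting arrows between objects. -/
theorem freeGen_ext {e : Idem P.T} {s t : CrossedModule.FreeGen (Basis.x (P := P)) e}
    (h₁ : s.fst.rel = t.fst.rel) (h₂ : Arrow.val s.snd = Arrow.val t.snd) : s = t := by
  obtain ⟨⟨r, x, hx⟩, g⟩ := s
  obtain ⟨⟨r', x', hx'⟩, g'⟩ := t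
  obtain rfl : r = r' := h₁
  obtain rfl : x = x' := Idem.ext (by
    rw [← Arrow.dom g, ← Arrow.dom g']
    exact congrArg (fun a => a * a⁻¹) h₂)
  obtain rfl : g = g' := Arrow.ext h₂
  rfl

/-- The class in `C_e` of a generator. -/
def genClass {e : Idem P.T} (s : CrossedModule.FreeGen (Basis.x (P := P)) e) : P.freeCM.C e :=
  QuotientGroup.mk' (CrossedModule.peiffer Basis.x ω e) (FreeGroup.of s)

/-- The condition for `q e` to be an arrow to `e` from an idempotent below `h⁻¹ h`, where
`h = l ρ τ`. -/
structure Liftable (e : Idem P.T) (s : P.rels) (q : P.T) : Prop where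
  cod : (q * e.val)⁻¹ * (q * e.val) = e.val
  mul_eq : (P.ρτ s.1.1)⁻¹ * P.ρτ s.1.1 * (q * e.val) = q * e.val

/-- The generator `((l, r, x), q e)` with `x = (q e) (q e)⁻¹`. -/
def Liftable.gen {e : Idem P.T} {s : P.rels} {q : P.T} (H : Liftable e s q) :
    CrossedModule.FreeGen (Basis.x (P := P)) e where
  fst := ⟨s, ⟨(q * e.val) * (q * e.val)⁻¹, idem_mul_inv _⟩,
    natLE_of_inv_mul_mul (idem_mul_inv _) (by rw [← mul_assoc, H.mul_eq])⟩
  snd := (⟨q * e.val, rfl, H.cod⟩ : Arrow _ _)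

theorem Liftable.of_freeGen {e : Idem P.T} (s : CrossedModule.FreeGen (Basis.x (P := P)) e) :
    Liftable e s.fst.rel (Arrow.val s.snd) := by
  refine ⟨?_, ?_⟩
  · rw [Arrow.mul_cod, Arrow.cod]
  · rw [Arrow.mul_cod]
    conv_lhs => rw [← Arrow.dom_mul s.snd]
    rw [← mul_assoc, s.fst.inv_mul_mul, Arrow.dom_mul]

theorem Liftable.gen_of_freeGen {e : Idem P.T}
    (s : CrossedModule.FreeGen (Basis.x (P := P)) e) : (Liftable.of_freeGen s).gen = s :=
  freeGen_ext rfl (Arrow.mul_cod s.snd)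

/-- Multiplied by `e`, the initial vertex has right idempotent `e`, and so do its right factors `q
e` and `h q e`, where `h = l ρ τ`. Equality of these two right idempotents says that `h⁻¹ h` fixes
`q e`. -/
theorem liftable_of_ψ {e : Idem P.T} {s : P.rels} {p q : P.T}
    (h : P.ψ (p * P.ρτ s.1.1 * q) = P.ψ e.val) : Liftable e s q := by
  have he := e.idem
  have ha : (p * P.ρτ s.1.1 * q * e.val)⁻¹ * (p * P.ρτ s.1.1 * q * e.val) = e.val :=
    (P.ψ_ker he (by rw [map_mul, h, ← map_mul, he])).2
  have h₁ : (q * e.val)⁻¹ * (q * e.val) = e.val :=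
    inv_mul_of_right_factor he ha (mul_assoc _ _ _) (by rw [mul_assoc, he])
  have h₂ : (P.ρτ s.1.1 * (q * e.val))⁻¹ * (P.ρτ s.1.1 * (q * e.val)) = e.val :=
    inv_mul_of_right_factor he ha (p := p) (by simp only [mul_assoc])
      (by simp only [mul_assoc, he])
  refine ⟨h₁, idem_mul_of_conj (idem_inv_mul _) ?_⟩
  rw [mul_inv'] at h₂
  rw [h₁]
  simpa only [mul_assoc] using h₂

open Classical in
/-- The element of `C_e` given by the edges `(p, l, r, q)`; it does not depend on `p`. -/
noncomputable def edgeVal (e : Idem P.T) (s : P.rels) (q : P.T) : P.freeCM.C e :=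
  -- The default `1` plays no part on paths whose vertices have the same image as `e`: there the
  -- condition always holds, by `liftable_of_ψ`.
  if H : Liftable e s q then genClass H.gen else 1

theorem edgeVal_eq {e : Idem P.T} {s : P.rels} {q : P.T} (H : Liftable e s q) :
    edgeVal e s q = genClass H.gen := dif_pos H

/-- The element of `C_e` given by an oriented edge. -/
noncomputable def sedgeVal (e : Idem P.T) (s : P.SEdge) : P.freeCM.C e :=
  bif s.fwd then edgeVal e s.edge.rel s.edge.q else (edgeVal e s.edge.rel s.edge.q)⁻¹

theorem sedgeVal_inv (e : Idem P.T) (s : P.SEdge) : sedgeVal e s.inv = (sedgeVal e s)⁻¹ := by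
  obtain ⟨s, _ | _⟩ := s
  · exact (_root_.inv_inv _).symm
  · rfl

/-- The element of `C_e` given by a sequence of oriented edges. -/
noncomputable def pathVal (e : Idem P.T) (k : List P.SEdge) : P.freeCM.C e :=
  (k.map (sedgeVal e)).prod

theorem pathVal_append (e : Idem P.T) (k j : List P.SEdge) :
    pathVal e (k ++ j) = pathVal e k * pathVal e j := by
  rw [pathVal, List.map_append, List.prod_append]
  rfl

/-- Left translation changes only the coordinate `p`, which the value ignores. This is what makes
the value multiplicative for `∗`, whose second factor is left translated. -/
theorem pathVal_lw (e : Idem P.T) (x : P.T) (k : List P.SEdge) :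
    pathVal e (k.map (SEdge.lw x)) = pathVal e k := by
  rw [pathVal, List.map_map]
  rfl

/-- This is the 2-cell relation. Writing it as `E E' = E' K`, the point is that `K = E^{∂E'}`, so
that the crossed module axiom turns it into an identity in a group. -/
theorem edgeVal_interchange {e : Idem P.T} {s s' : P.rels} {p q q' : P.T}
    (h : P.ψ (p * P.ρτ s.1.1 * (q * P.ρτ s'.1.1 * q')) = P.ψ e.val) :
    edgeVal e s (q * P.ρτ s'.1.1 * q') * edgeVal e s' q' =
      edgeVal e s' q' * edgeVal e s (q * P.ρτ s'.1.2 * q') := by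
  have H : Liftable e s (q * P.ρτ s'.1.1 * q') := liftable_of_ψ h
  have H' : Liftable e s' q' := liftable_of_ψ (p := p * P.ρτ s.1.1 * q) (by
    rw [← h]; simp only [mul_assoc])
  have K : Liftable e s (q * P.ρτ s'.1.2 * q') := liftable_of_ψ (p := p) (by
    rw [← h]; simp only [map_mul, P.ψ_rel s'])
  rw [edgeVal_eq H, edgeVal_eq H', edgeVal_eq K]
  have hact : P.freeCM.act (P.freeCM.bd e (genClass H'.gen)) (genClass H.gen) =
      genClass K.gen := by
    change QuotientGroup.mk' (CrossedModule.peiffer Basis.x ω e) (CrossedModule.freeAct Basis.x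
      (CrossedModule.freeBd Basis.x ω e (FreeGroup.of H'.gen)) (FreeGroup.of H.gen)) = _
    rw [CrossedModule.freeAct_of, CrossedModule.freeBd_of]
    refine congrArg genClass (freeGen_ext rfl ?_)
    set c := q' * e.val with hc
    change q * P.ρτ s'.1.1 * q' * e.val * (c⁻¹ *
      (c * c⁻¹ * P.ρτ (wordInv s'.1.1 * s'.1.2) * (c * c⁻¹) * c)) = q * P.ρτ s'.1.2 * q' * e.val
    -- With `h'` and `k'` the images of `l'` and `r'`, the boundary of `E'` is `(h' c)⁻¹ (k' c)`,
    -- and the arrow of `E` is `q h' c`. Their product is `q k' c`, because `h' c` and `k' c` agree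
    -- in `M` and so `h' c (h' c)⁻¹` fixes `k' c`.
    have hf : P.ρτ s'.1.1 * c * (P.ρτ s'.1.1 * c)⁻¹ * (P.ρτ s'.1.2 * c) = P.ρτ s'.1.2 * c := by
      apply idem_mul_eq_of_ψ (idem_mul_inv _)
      rw [map_mul, map_mul P.ψ _ c, ← P.ψ_rel, ← map_mul, ← map_mul, mul_inv_mul, map_mul]
    rw [mul_inv'] at hf
    calc _ = q * P.ρτ s'.1.1 * (q' * e.val) * (c⁻¹ * (c * c⁻¹ *
          P.ρτ (wordInv s'.1.1 * s'.1.2) * (c * c⁻¹) * c)) := by simp only [mul_assoc]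
      _ = q * P.ρτ s'.1.1 * (c * c⁻¹ * c) * c⁻¹ * P.ρτ (wordInv s'.1.1 * s'.1.2) *
          (c * c⁻¹ * c) := by rw [← hc]; simp only [mul_assoc]
      _ = q * (P.ρτ s'.1.1 * c * (c⁻¹ * (P.ρτ s'.1.1)⁻¹) * (P.ρτ s'.1.2 * c)) := by
        rw [mul_inv_mul, map_mul, P.ρτ_wordInv]; simp only [mul_assoc]
      _ = _ := by rw [hf, hc]; simp only [mul_assoc]
  rw [← hact, P.freeCM.act_bd]
  group

theorem pathVal_eq_of_hty {e : Idem P.T} {a b : P.T} {k j : List P.SEdge} (h : Hty a b k j)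
    (ha : P.ψ a = P.ψ e.val) : pathVal e k = pathVal e j := by
  induction h with
  | refl => rfl
  | symm _ ih => exact (ih ha).symm
  | trans _ _ ih₁ ih₂ => exact (ih₁ ha).trans (ih₂ ha)
  | append h₁ _ ih₁ ih₂ =>
    -- The second path starts at a vertex with the same image under `ψ`, so the induction hypothesis
    -- applies to it.
    rw [pathVal_append, pathVal_append, ih₁ ha, ih₂ (by rw [← h₁.isPath.1.ψ_eq, ha])]
  | cancel s => simp [pathVal, sedgeVal_inv]
  | cell p q p' q' s s' =>
    have := edgeVal_interchange (s := s) (s' := s') (p := p) (q := q * p') (q' := q') (by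
      rw [← ha]; simp only [mul_assoc])
    simpa [pathVal, sedgeVal] using this

theorem pathVal_eq_of_mk_eq {e : Idem P.T} {α β : P.EdgePath} (ha : α.d = e.val)
    (h : Pi1.mk α = Pi1.mk β) : pathVal e α.edges = pathVal e β.edges :=
  pathVal_eq_of_hty (Quotient.exact h : α ≈ β).2.2 (congrArg _ ha)

/-- The homomorphism `star_e^⋈ → C_e` that is given on a class by the value of a path. -/
noncomputable def starVal (e : Idem P.T) : StarBow e →* P.freeCM.C e :=
  MonoidHom.mk' (fun α => pathVal e α.exists_adapted.choose.edges) (by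
    intro α β
    obtain ⟨ha, ha'⟩ := α.exists_adapted.choose_spec
    obtain ⟨hb, hb'⟩ := β.exists_adapted.choose_spec
    obtain ⟨hc, hc'⟩ := (α * β).exists_adapted.choose_spec
    set a := α.exists_adapted.choose
    set b := β.exists_adapted.choose
    have h : Pi1.mk (EdgePath.star a b) = (α * β).1 := by
      change Pi1.star (Pi1.mk a) (Pi1.mk b) = Pi1.star α.1 β.1
      rw [ha', hb']
    -- The representative chosen for `α * β` may be replaced by the explicit path `a ∗ b`, by
    -- homotopy invariance.
    rw [← pathVal_eq_of_mk_eq (ha.star hb).d_eq (h.trans hc'.symm)]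
    change pathVal e ((a.rw b.d).edges ++ (b.lw a.r).edges) = _
    rw [pathVal_append, hb.d_eq, ha.rw_eq]
    exact congrArg _ (pathVal_lw e a.r b.edges))

theorem starVal_eq {e : Idem P.T} (α : StarBow e) {a : P.EdgePath} (ha : a.d = e.val)
    (h : Pi1.mk a = α.1) : starVal e α = pathVal e a.edges :=
  (pathVal_eq_of_mk_eq ha (h.trans α.exists_adapted.choose_spec.2.symm)).symm

/-! #### The two maps are mutually inverse -/

theorem EdgePath.lw_single (x p : P.T) (s : P.rels) (q : P.T) :
    (EdgePath.single ⟨p, s, q⟩).lw x = EdgePath.single ⟨x * p, s, q⟩ := by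
  ext1
  · exact SEdge.dom_lw x ⟨⟨p, s, q⟩, true⟩ |>.symm
  · exact SEdge.cod_lw x ⟨⟨p, s, q⟩, true⟩ |>.symm
  · rfl

theorem EdgePath.rw_single (x p : P.T) (s : P.rels) (q : P.T) :
    (EdgePath.single ⟨p, s, q⟩).rw x = EdgePath.single ⟨p, s, q * x⟩ := by
  ext1
  · exact SEdge.dom_rw x ⟨⟨p, s, q⟩, true⟩ |>.symm
  · exact SEdge.cod_rw x ⟨⟨p, s, q⟩, true⟩ |>.symm
  · rfl

/-- Translating the edge `(x h⁻¹, l, r, x)` by an arrow `g` from `x` absorbs both copies of `x`,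
since `g⁻¹ x = g⁻¹` and `x g = g`. -/
theorem toStar_genClass {e : Idem P.T} (s : CrossedModule.FreeGen (Basis.x (P := P)) e) :
    (P.toStar.map e (genClass s) : StarBow e).1 =
      Pi1.mk (EdgePath.single ⟨(Arrow.val s.snd)⁻¹ * (P.ρτ s.fst.rel.1.1)⁻¹, s.fst.rel,
        Arrow.val s.snd⟩) := by
  have h : P.toStar.map e (genClass s) = P.starCM.act s.snd (basisStar s.fst) :=
    CrossedModule.freeLift_mk_of Basis.x ω P.starCM basisStar bd_basisStar s
  rw [h]
  change Pi1.mk (((EdgePath.single _).rw (Arrow.val s.snd)).lw (Arrow.val s.snd)⁻¹) = _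
  have hi : (Arrow.val s.snd)⁻¹ * s.fst.x.val = (Arrow.val s.snd)⁻¹ := by
    rw [← Arrow.dom s.snd, ← mul_assoc, inv_mul_inv]
  rw [EdgePath.rw_single, EdgePath.lw_single, Arrow.dom_mul, ← mul_assoc, hi]

theorem starVal_toStar (e : Idem P.T) (c : P.freeCM.C e) : starVal e (P.toStar.map e c) = c := by
  have : (starVal e).comp (P.toStar.map e) = MonoidHom.id (P.freeCM.C e) := by
    refine QuotientGroup.monoidHom_ext _ (FreeGroup.ext_hom _ _ fun s => ?_)
    change starVal e (P.toStar.map e (genClass s)) = genClass s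
    have H := Liftable.of_freeGen s
    have hd : (Arrow.val s.snd)⁻¹ * (P.ρτ s.fst.rel.1.1)⁻¹ * P.ρτ s.fst.rel.1.1 *
        Arrow.val s.snd = e.val := by
      have := H.mul_eq
      rw [Arrow.mul_cod] at this
      rw [mul_assoc (Arrow.val s.snd)⁻¹, mul_assoc, this, Arrow.cod]
    rw [starVal_eq _ hd (toStar_genClass s).symm]
    change (List.map (sedgeVal e) [_]).prod = _
    rw [List.map_singleton, List.prod_singleton]
    change edgeVal e s.fst.rel (Arrow.val s.snd) = _
    rw [edgeVal_eq H, Liftable.gen_of_freeGen]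
  exact DFunLike.congr_fun this c

/-- This justifies forgetting `p`. With `c = h q e`, the generator gives an edge with left
coordinate `c⁻¹`, while the translated edge has `(p c)⁻¹ p = c⁻¹ p⁻¹ p`; the two agree because `p⁻¹
p` fixes `c`. -/
theorem toStar_edgeVal {e : Idem P.T} {p q : P.T} {s : P.rels}
    (h : P.ψ (p * P.ρτ s.1.1 * q) = P.ψ e.val) :
    (P.toStar.map e (edgeVal e s q) : StarBow e).1 =
      Pi1.mk (EdgePath.single ⟨(p * P.ρτ s.1.1 * q)⁻¹ * p, s, q * e.val⟩) := by
  have H : Liftable e s q := liftable_of_ψ h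
  have he := e.idem
  have ha := P.ψ_ker he h
  rw [edgeVal_eq H, toStar_genClass]
  change Pi1.mk (EdgePath.single ⟨(q * e.val)⁻¹ * (P.ρτ s.1.1)⁻¹, s, q * e.val⟩) = _
  set c := P.ρτ s.1.1 * (q * e.val) with hc
  have hae : p * P.ρτ s.1.1 * q = p * c := by
    calc _ = p * P.ρτ s.1.1 * q * e.val := by rw [← ha.2, ← mul_assoc _ _⁻¹, mul_inv_mul]
      _ = _ := by simp only [hc, mul_assoc]
  rw [hae] at ha ⊢
  have hce : c * e.val = c := by simp only [hc, mul_assoc, he]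
  have hcc : c⁻¹ * c = e.val := inv_mul_of_right_factor he ha.2 rfl hce
  -- Both `c` and `p c` have right idempotent `e`.
  have hpc : p⁻¹ * p * c = c := by
    refine idem_mul_of_conj (idem_inv_mul p) ?_
    rw [hcc, ← ha.2, mul_inv' p c]
    simp only [mul_assoc]
  have hpc' : c⁻¹ * (p⁻¹ * p) = c⁻¹ := by
    rw [← idem_inv (idem_inv_mul p), ← mul_inv', hpc]
  rw [← mul_inv', ← hc, mul_inv' p c, mul_assoc, hpc']

theorem toStar_sedgeVal {e : Idem P.T} (s : P.SEdge) (h : P.ψ s.dom = P.ψ e.val) :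
    (P.toStar.map e (sedgeVal e s) : StarBow e).1 =
      Pi1.mk (((⟨s.dom, s.cod, [s], rfl, rfl⟩ : P.EdgePath).rw e.val).lw s.dom⁻¹) := by
  have he := e.idem
  obtain ⟨⟨p, s, q⟩, _ | _⟩ := s
  · have h' : P.ψ (p * P.ρτ s.1.1 * q) = P.ψ e.val := by
      rw [← h]
      simp [SEdge.dom, Edge.cod, P.ψ_rel]
    have ha := P.ψ_ker he h
    have hb := P.ψ_ker he h'
    change (P.toStar.map e (edgeVal e s q)⁻¹ : StarBow e).1 = _
    rw [map_inv]
    change Pi1.starInv (P.toStar.map e (edgeVal e s q) : StarBow e).1 = _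
    rw [toStar_edgeVal h']
    refine congrArg Pi1.mk ?_
    set a := p * P.ρτ s.1.2 * q with hav
    set b := p * P.ρτ s.1.1 * q with hbv
    change a * a⁻¹ = e.val ∧ a⁻¹ * a = e.val at ha
    have hd : b⁻¹ * p * P.ρτ s.1.1 * (q * e.val) = e.val := by
      calc _ = b⁻¹ * b * e.val := by simp only [hbv, mul_assoc]
        _ = _ := by rw [hb.2, he]
    have hr : b⁻¹ * p * P.ρτ s.1.2 * (q * e.val) = b⁻¹ * a := by
      calc _ = b⁻¹ * (a * e.val) := by simp only [hav, mul_assoc]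
        _ = _ := by rw [← ha.2, ← mul_assoc a, mul_inv_mul]
    -- The forward edge is normalised by `b⁻¹`, and inversion for `∗` translates its reverse by
    -- `(b⁻¹ a)⁻¹`. Together these give `a⁻¹`, the normalisation of the backward edge, which starts
    -- at `a`.
    have hi : (b⁻¹ * a)⁻¹ * b⁻¹ = a⁻¹ := by
      rw [mul_inv', inv_inv', mul_assoc, hb.1, ← ha.1, ← mul_assoc, inv_mul_inv]
    unfold EdgePath.starInv
    rw [show (EdgePath.single ⟨b⁻¹ * p, s, q * e.val⟩ : P.EdgePath).d = e.val from hd,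
      show (EdgePath.single ⟨b⁻¹ * p, s, q * e.val⟩ : P.EdgePath).r = b⁻¹ * a from hr,
      idem_inv he]
    ext1
    · change (b⁻¹ * a)⁻¹ * (b⁻¹ * p * P.ρτ s.1.2 * (q * e.val) * e.val) = a⁻¹ * (a * e.val)
      rw [hr, mul_assoc b⁻¹, ← mul_assoc, hi]
    · change (b⁻¹ * a)⁻¹ * (b⁻¹ * p * P.ρτ s.1.1 * (q * e.val) * e.val) = a⁻¹ * (b * e.val)
      rw [← hi]
      simp only [hbv, mul_assoc, he]
    · change [(⟨⟨(b⁻¹ * a)⁻¹ * (b⁻¹ * p), s, q * e.val * e.val⟩, false⟩ : P.SEdge)] =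
        [⟨⟨a⁻¹ * p, s, q * e.val⟩, false⟩]
      rw [← mul_assoc, hi, mul_assoc q, he]
  · change (P.toStar.map e (edgeVal e s q) : StarBow e).1 = _
    rw [toStar_edgeVal h, ← EdgePath.lw_single, ← EdgePath.rw_single]
    rfl

theorem toStar_pathVal {e : Idem P.T} (α : P.EdgePath) (h : P.ψ α.d = P.ψ e.val) :
    (P.toStar.map e (pathVal e α.edges) : StarBow e).1 =
      Pi1.mk ((α.rw e.val).lw α.d⁻¹) := by
  obtain ⟨a, b, k, hk⟩ := α
  change P.ψ a = P.ψ e.val at h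
  induction k generalizing a with
  | nil =>
    obtain rfl : a = b := hk
    change (P.toStar.map e 1 : StarBow e).1 = _
    rw [map_one]
    have h₁ : a⁻¹ * (a * e.val) = e.val := by rw [← mul_assoc, (P.ψ_ker e.idem h).2, e.idem]
    exact congrArg Pi1.mk (EdgePath.ext h₁.symm h₁.symm rfl)
  | cons s k ih =>
    obtain ⟨rfl, hk⟩ := hk
    have h' : P.ψ s.cod = P.ψ e.val := by
      rw [← h]
      exact (IsPath.ψ_eq (k := [s]) ⟨rfl, rfl⟩).symm
    change (P.toStar.map e (sedgeVal e s * pathVal e k) : StarBow e).1 = _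
    rw [map_mul]
    change Pi1.star (P.toStar.map e (sedgeVal e s) : StarBow e).1
      (P.toStar.map e (pathVal e k) : StarBow e).1 = _
    rw [toStar_sedgeVal s h, ih s.cod hk h']
    refine congrArg Pi1.mk ?_
    have he := e.idem
    have hd : s.cod⁻¹ * (s.cod * e.val) = e.val := by rw [← mul_assoc, (P.ψ_ker he h').2, he]
    -- The tail is translated first by `s.cod⁻¹`, and then in the product `∗` by the end of the
    -- translated first edge. The total is `s.dom⁻¹`, the translation required for the whole path.
    have hr : s.dom⁻¹ * (s.cod * e.val) * s.cod⁻¹ = s.dom⁻¹ := by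
      have h₁ : s.cod * e.val = s.cod := by
        rw [← (P.ψ_ker he h').2, ← mul_assoc, mul_inv_mul]
      rw [h₁, mul_assoc, (P.ψ_ker he h').1, ← (P.ψ_ker he h).1, ← mul_assoc, inv_mul_inv]
    ext1
    · change s.dom⁻¹ * (s.dom * e.val) * (s.cod⁻¹ * (s.cod * e.val)) = s.dom⁻¹ * (s.dom * e.val)
      rw [hd, mul_assoc, mul_assoc, he]
    · change s.dom⁻¹ * (s.cod * e.val) * (s.cod⁻¹ * (b * e.val)) = s.dom⁻¹ * (b * e.val)
      rw [← mul_assoc, hr]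
    · change ((s.rw e.val).lw s.dom⁻¹).rw (s.cod⁻¹ * (s.cod * e.val)) ::
        ((k.map (SEdge.rw e.val)).map (SEdge.lw s.cod⁻¹)).map
          (SEdge.lw (s.dom⁻¹ * (s.cod * e.val))) =
        (s.rw e.val).lw s.dom⁻¹ :: (k.map (SEdge.rw e.val)).map (SEdge.lw s.dom⁻¹)
      rw [hd, ← SEdge.lw_rw, SEdge.rw_rw, he]
      congr 1
      rw [List.map_map (f := SEdge.lw s.cod⁻¹)]
      refine List.map_congr_left fun t _ => ?_
      exact (SEdge.lw_lw _ _ t).trans (by rw [hr])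

theorem toStar_starVal (e : Idem P.T) (α : StarBow e) :
    (P.toStar.map e (starVal e α) : StarBow e) = α := by
  obtain ⟨a, ha, ha'⟩ := α.exists_adapted
  refine Subtype.ext ?_
  rw [starVal_eq α ha.d_eq ha', toStar_pathVal a (by rw [ha.d_eq]), ha.rw_eq, ha.d_eq,
    idem_inv e.idem, ha.lw_eq, ha']

variable (P) in
/-- The isomorphism from the free crossed module to `S^⋈`. -/
noncomputable def starIso : CrossedModule.Iso P.freeCM P.starCM where
  map e := MulEquiv.mk' ⟨P.toStar.map e, starVal e, starVal_toStar e, toStar_starVal e⟩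
    (map_mul (P.toStar.map e))
  bd_map := P.toStar.bd_map
  act_map := P.toStar.act_map

end InvPresentation

end Presentation

/-- The crossed module `P.freeCM` is free on `ω`, and it is isomorphic to `S^⋈ → 𝒯 ⇉ E(𝒯)`, by an
isomorphism that sends the basis element `(l, r, x)` to the class of the edge `(x h⁻¹, l, r, x)`
with `h = l ρ τ`. -/
theorem mainTheorem2 {X : Type u} {M : Type v} [InverseMonoid M] (P : InvPresentation X M) :
    CrossedModule.IsFreeOn.{u, u, u, u, w} P.freeCM InvPresentation.Basis.x InvPresentation.ω
      InvPresentation.freeCMBasis ∧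
    ∃ φ : CrossedModule.Iso P.freeCM P.starCM, ∀ s : P.Basis,
      (φ.map s.x (InvPresentation.freeCMBasis s) : InvPresentation.StarBow s.x).1 =
        InvPresentation.basisEdge s := by
  refine ⟨CrossedModule.free_isFreeOn _ _, P.starIso, fun s => ?_⟩
  exact congrArg Subtype.val (CrossedModule.freeLift_freeBasis InvPresentation.Basis.x
    InvPresentation.ω P.starCM InvPresentation.basisStar InvPresentation.bd_basisStar s)
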